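/- **Setting.** Consider a Runge–Kutta method with $s\ge 1$ stages, real coefficients $A\in\mathbb R^{s\times s}$, $b\in\mathbb R^s$, and put $$r(z)=1+z\,b^T(I-zA)^{-1}\mathbb 1,\qquad q(z)=b^T(I-zA)^{-1},\qquad \mathbb 1=(1,\dots,1)^T .$$ Assume that it is $A$-stable ($I-zA$ is invertible and $|r(z)|\le 1$ for $\operatorname{Re}z\le 0$), of classical order at least one ($\sum_i b_i=1$), that $|r(iy)|<1$ for all real $y\ne 0$, that $A$ is invertible, and that $b^TA^{-1}=(0,\dots,0,1)$. Let $\Delta(\zeta)=\bigl(A+\frac{\zeta}{1-\zeta}\mathbb 1b^T\bigr)^{-1}$, define $E_n(z)$ by $(\Delta(\zeta)-zI)^{-1}=\sum_{n\ge0}E_n(z)\zeta^n$ near $\zeta=0$, and let $e_n(z)$ be the last row of $E_n(z)$ (so $e_n(z)=r(z)^nq(z)$). For $\xi>0$ let $$\gamma(\xi)=\inf_{-\xi\le\operatorname{Re}z<0}\frac{\log|r(z)|}{\operatorname{Re}z},$$ where the quotient is read as $+\infty$ if $r(z)=0$. Let $K(z,x)=\frac{1}{2\sqrt{z/i}}\,e^{-|x|\sqrt{z/i}}$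 with $\sqrt{z/i}=e^{-i\pi/4}\sqrt z$ be the transfer operator of the one-dimensional Schrödinger equation, $x\in\mathbb R$, $d=|x|$, and for $\lambda>0$ let $G(\lambda,x)=K(\lambda e^{-i\pi},x)-K(\lambda e^{i\pi},x)$ be the difference of its values on the lower and the upper side of the branch cut $(-\infty,0]$. Let $h>0$, $t_n=nh$, $B\ge1$, $L_0>0$, $L_j=(1+B)L_{j-1}$ for $j\ge1$, and $$I_{n,j}=\frac{h}{2\pi i}\int_{L_{j-1}}^{L_j}G(\lambda,x)\,e_n(-h\lambda)\,d\lambda .$$ Let $\tau_{n,j}(Q)$ be the error in the approximation of $I_{n,j}$ by the $Q$-node Gauss–Legendre rule transplanted affinely from $[-1,1]$ to $[L_{j-1},L_j]$. Let $\|\cdot\|$ be any norm on row vectors in $\mathbb C^s$, and $$C_{q}=\sup_{\operatorname{Re}z\le0}\|q(z)\| .$$ **Corollary 4.6.** $C_q<\infty$, and for all $n\ge0$, $j\ge1$, $Q\ge1$ and all $x,h,B,L_0$ as above $$\|\tau_{n,j}(Q)\|\le C_{q}\,h\,\frac{2BL_{j-1}^{1/2}}{\pi}\min_{\varrho\in(1,\varrho_{\max})}\frac{\varrho^{-2Q+1}}{\varrho-1}\,\eta_-^{-1/2}\exp\Bigl(dL_{j-1}^{1/2}\bigl(1+(\varrho/2)^2\bigr)^{1/4}\eta_+^{1/2}-L_{j-1}t_n\,\gamma(hL_{j-1}\eta_+)\,\eta_-\Bigr),$$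 where the minimum is attained and $$\eta_\pm=1+\tfrac B4\bigl(\pm(\varrho+\varrho^{-1})+2\bigr),\qquad \varrho_{\max}=1+\tfrac2B\bigl(1+\sqrt{1+B}\bigr).$$ -/

import Mathlib

open scoped Polynomial

noncomputable section

namespace SchrodingerCQ

/-! ### Gauss-Legendre quadrature on `[-1, 1]` -/

/-- The Gauss quadrature formula with weight function `1` and `Q` nodes on `[-1, 1]`: `Q` distinct
nodes in `[-1, 1]` and `Q` real weights for which the formula integrates every polynomial of degree
less than `2 Q` exactly. -/
structure GaussLegendreRule (Q : ℕ) where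
  node : Fin Q → ℝ
  weight : Fin Q → ℝ
  node_injective : Function.Injective node
  node_mem : ∀ k, node k ∈ Set.Icc (-1 : ℝ) 1
  exact : ∀ p : ℝ[X], p.natDegree < 2 * Q →
    ∑ k, weight k * p.eval (node k) = ∫ x in (-1 : ℝ)..1, p.eval x

/-- Integration over `[-1, 1]` as a linear functional on polynomials. -/
def integralPoly : ℝ[X] →ₗ[ℝ] ℝ where
  toFun p := ∫ x in (-1 : ℝ)..1, p.eval x
  map_add' p q := by
    simp only [Polynomial.eval_add]
    exact intervalIntegral.integral_add (p.continuous.intervalIntegrable _ _)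
      (q.continuous.intervalIntegrable _ _)
  map_smul' c p := by simp

theorem integralPoly_pos {p : ℝ[X]} (h0 : p ≠ 0)
    (hp : ∀ x ∈ Set.Icc (-1 : ℝ) 1, 0 ≤ p.eval x) : 0 < integralPoly p := by
  refine intervalIntegral.integral_pos (by norm_num) p.continuous.continuousOn
    (fun x hx => hp x ⟨hx.1.le, hx.2⟩) ?_
  by_contra! hc
  refine h0 (Polynomial.eq_zero_of_infinite_isRoot p ?_)
  refine Set.Infinite.mono (s := Set.Icc (-1 : ℝ) 1) (fun x hx => ?_)
    (Set.Icc_infinite (by norm_num))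
  exact le_antisymm (hc x hx) (hp x hx)

theorem exists_monic_orthogonal (Q : ℕ) :
    ∃ P : ℝ[X], P.Monic ∧ P.natDegree = Q ∧
      ∀ q : ℝ[X], q.degree < (Q : WithBot ℕ) → integralPoly (P * q) = 0 := by
  let V := Polynomial.degreeLT ℝ Q
  have : FiniteDimensional ℝ V :=
    Module.Finite.equiv (Polynomial.degreeLTEquiv ℝ Q).symm
  let T : V →ₗ[ℝ] Module.Dual ℝ V :=
    { toFun := fun p => integralPoly ∘ₗ (LinearMap.mulLeft ℝ (p : ℝ[X])) ∘ₗ V.subtype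
      map_add' := fun p q => by ext r; simp [add_mul]
      map_smul' := fun c p => by ext r; simp }
  have hinj : Function.Injective T := by
    rw [← LinearMap.ker_eq_bot, LinearMap.ker_eq_bot']
    intro p hp
    by_contra hne
    have h1 : T p p = 0 := by rw [hp]; rfl
    have h2 : (p : ℝ[X]) ≠ 0 := fun h => hne (Subtype.ext h)
    have h3 : 0 < integralPoly ((p : ℝ[X]) * p) :=
      integralPoly_pos (mul_ne_zero h2 h2)
        (fun x _ => by rw [Polynomial.eval_mul]; exact mul_self_nonneg _)
    exact h3.ne' h1
  have hsurj : Function.Surjective T :=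
    (LinearMap.injective_iff_surjective_of_finrank_eq_finrank
      (Subspace.dual_finrank_eq (K := ℝ) (V := V)).symm).1 hinj
  obtain ⟨p, hp⟩ := hsurj
    (integralPoly ∘ₗ (LinearMap.mulLeft ℝ (Polynomial.X ^ Q : ℝ[X])) ∘ₗ V.subtype)
  have hdeg : (p : ℝ[X]).degree < (Q : WithBot ℕ) := Polynomial.mem_degreeLT.1 p.2
  refine ⟨Polynomial.X ^ Q - (p : ℝ[X]), ?_, ?_, ?_⟩
  · exact (Polynomial.monic_X_pow Q).sub_of_left (by simpa using hdeg)
  · apply Polynomial.natDegree_eq_of_degree_eq_some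
    rw [Polynomial.degree_sub_eq_left_of_degree_lt (by rw [Polynomial.degree_X_pow]; exact hdeg),
      Polynomial.degree_X_pow]
  · intro q hq
    have := LinearMap.congr_fun hp ⟨q, Polynomial.mem_degreeLT.2 hq⟩
    have h4 : integralPoly ((p : ℝ[X]) * q) = integralPoly (Polynomial.X ^ Q * q) := this
    rw [sub_mul, map_sub, h4, sub_self]

theorem exists_orthogonal_with_nodes (Q : ℕ) :
    ∃ P : ℝ[X], P.Monic ∧ P.natDegree = Q ∧
      (∀ q : ℝ[X], q.degree < (Q : WithBot ℕ) → integralPoly (P * q) = 0) ∧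
      P.roots.Nodup ∧ P.roots.card = Q ∧ ∀ a ∈ P.roots, a ∈ Set.Icc (-1 : ℝ) 1 := by
  obtain ⟨P, hm, hd, ho⟩ := exists_monic_orthogonal Q
  have hP0 : P ≠ 0 := hm.ne_zero
  have key : ∀ f h : ℝ[X], f * h = P → 0 < f.natDegree →
      ¬ ((∀ x ∈ Set.Icc (-1 : ℝ) 1, 0 ≤ f.eval x) ∨ ∀ x ∈ Set.Icc (-1 : ℝ) 1, f.eval x ≤ 0) := by
    intro f h hfh hf hs
    have hf0 : f ≠ 0 := fun h0 => by simp [h0] at hf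
    have hh0 : h ≠ 0 := fun h0 => hP0 (by rw [← hfh, h0, mul_zero])
    have hdeg : f.natDegree + h.natDegree = Q := by
      rw [← hd, ← hfh, Polynomial.natDegree_mul hf0 hh0]
    have hz : integralPoly (P * h) = 0 := ho h (by
      rw [Polynomial.degree_eq_natDegree hh0]; exact_mod_cast (by omega))
    rcases hs with hs | hs
    · refine (integralPoly_pos (p := P * h) (mul_ne_zero hP0 hh0) fun x hx => ?_).ne' hz
      rw [← hfh, Polynomial.eval_mul, Polynomial.eval_mul, mul_assoc]
      exact mul_nonneg (hs x hx) (mul_self_nonneg _)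
    · have hz' : integralPoly (-(P * h)) = 0 := by rw [map_neg, hz, neg_zero]
      refine (integralPoly_pos (p := -(P * h)) (neg_ne_zero.2 (mul_ne_zero hP0 hh0))
        fun x hx => ?_).ne' hz'
      rw [← hfh, Polynomial.eval_neg, Polynomial.eval_mul, Polynomial.eval_mul, mul_assoc,
        ← neg_mul]
      exact mul_nonneg (neg_nonneg.2 (hs x hx)) (mul_self_nonneg _)
  refine ⟨P, hm, hd, ho, ?_, ?_, ?_⟩
  · rw [Multiset.nodup_iff_count_le_one]
    intro a
    by_contra! hc
    rw [Polynomial.count_roots] at hc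
    have hdvd : (Polynomial.X - Polynomial.C a) ^ 2 ∣ P :=
      (pow_dvd_pow _ hc).trans (Polynomial.pow_rootMultiplicity_dvd P a)
    obtain ⟨h, hh⟩ := hdvd
    refine key _ h hh.symm (by simp) (Or.inl fun x _ => ?_)
    rw [Polynomial.eval_pow]
    exact sq_nonneg _
  · obtain ⟨q, hq, hcard, hroots⟩ := Polynomial.exists_prod_multiset_X_sub_C_mul P
    by_contra hne
    have hq0 : q ≠ 0 := fun h0 => hP0 (by rw [← hq, h0, mul_zero])
    have hnr : ∀ x : ℝ, q.eval x ≠ 0 := fun x hx => by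
      have : x ∈ q.roots := (Polynomial.mem_roots hq0).2 hx
      simp [hroots] at this
    refine key q _ (by rw [mul_comm]; exact hq) (by omega) ?_
    by_contra! hc
    obtain ⟨⟨x, -, hx⟩, y, -, hy⟩ := hc
    obtain ⟨z, -, hz⟩ := (isPreconnected_univ (α := ℝ)).intermediate_value
      (Set.mem_univ x) (Set.mem_univ y) q.continuous.continuousOn ⟨hx.le, hy.le⟩
    exact hnr z hz
  · intro a ha
    have hr : P.IsRoot a := (Polynomial.mem_roots hP0).1 ha
    obtain ⟨h, hh⟩ := Polynomial.dvd_iff_isRoot.2 hr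
    have := key _ h hh.symm (by simp)
    by_contra hmem
    apply this
    rcases lt_or_ge a (-1) with h1 | h1
    · left
      intro x hx
      simp only [Polynomial.eval_sub, Polynomial.eval_X, Polynomial.eval_C]
      linarith [hx.1]
    · right
      intro x hx
      have h2 : 1 < a := by
        by_contra! h2
        exact hmem ⟨h1, h2⟩
      simp only [Polynomial.eval_sub, Polynomial.eval_X, Polynomial.eval_C]
      linarith [hx.2]

/-- The Gauss-Legendre rule exists for every number of nodes. -/
instance gaussLegendreRule_nonempty (Q : ℕ) : Nonempty (GaussLegendreRule Q) := by
  obtain ⟨P, hm, hd, ho, hnd, hcard, hmem⟩ := exists_orthogonal_with_nodes Q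
  have hfc : P.roots.toFinset.card = Q := by rw [Multiset.toFinset_card_of_nodup hnd, hcard]
  let e := (P.roots.toFinset.equivFinOfCardEq hfc).symm
  let v : Fin Q → ℝ := fun k => (e k : ℝ)
  have hv : Function.Injective v := fun i j hij => e.injective (Subtype.ext hij)
  have hvr : ∀ k, v k ∈ P.roots := fun k => Multiset.mem_toFinset.1 (e k).2
  refine ⟨⟨v, fun k => integralPoly (Lagrange.basis Finset.univ v k), hv,
    fun k => hmem _ (hvr k), fun p hp => ?_⟩⟩
  change _ = integralPoly p
  set r := p %ₘ P with hr
  have hpr : r + P * (p /ₘ P) = p := Polynomial.modByMonic_add_div p P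
  have hq : (p /ₘ P).degree < (Q : WithBot ℕ) := by
    rcases Nat.eq_zero_or_pos Q with hQ | hQ
    · omega
    · refine lt_of_le_of_lt Polynomial.degree_le_natDegree ?_
      rw [Polynomial.natDegree_divByMonic p hm, hd]
      exact_mod_cast (by omega)
  have hrd : r.degree < ((Finset.univ : Finset (Fin Q)).card : WithBot ℕ) := by
    have := Polynomial.degree_modByMonic_lt p hm
    rw [Polynomial.degree_eq_natDegree hm.ne_zero, hd] at this
    simpa using this
  have hint : integralPoly p = integralPoly r := by
    rw [← hpr, map_add, ho _ hq, add_zero]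
  have hev : ∀ k, p.eval (v k) = r.eval (v k) := fun k => by
    have h0 : P.eval (v k) = 0 := (Polynomial.mem_roots hm.ne_zero).1 (hvr k)
    conv_lhs => rw [← hpr]
    rw [Polynomial.eval_add, Polynomial.eval_mul, h0, zero_mul, add_zero]
  have hlag := Lagrange.eq_interpolate (s := Finset.univ) (v := v) hv.injOn hrd
  rw [hint]
  conv_rhs => rw [hlag, Lagrange.interpolate_apply, map_sum]
  refine Finset.sum_congr rfl fun k _ => ?_
  rw [hev k, ← Polynomial.smul_eq_C_mul, map_smul, smul_eq_mul, mul_comm]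

/-! ### Runge-Kutta methods -/

/-- The Butcher coefficients `A`, `b` of a Runge-Kutta method with `m + 1` stages. The abscissae `c`
do not enter the convolution weights and are not recorded. -/
structure RungeKutta (m : ℕ) where
  A : Matrix (Fin (m + 1)) (Fin (m + 1)) ℝ
  b : Fin (m + 1) → ℝ

namespace RungeKutta

variable {m : ℕ} (R : RungeKutta m)

/-- The coefficient matrix, viewed over `ℂ`. -/
def AC : Matrix (Fin (m + 1)) (Fin (m + 1)) ℂ := R.A.map Complex.ofReal

/-- The weights, viewed over `ℂ`. -/
def bC : Fin (m + 1) → ℂ := fun i => (R.b i : ℂ)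

/-- The stability function `r(z) = 1 + z bᵀ (I - z A)⁻¹ 𝟙`. -/
def stab (z : ℂ) : ℂ :=
  1 + z * dotProduct R.bC (Matrix.mulVec (1 - z • R.AC)⁻¹ (fun _ => 1))

/-- The row vector `q(z) = bᵀ (I - z A)⁻¹`. -/
def q (z : ℂ) : Fin (m + 1) → ℂ := Matrix.vecMul R.bC (1 - z • R.AC)⁻¹

/-- The symbol `Δ(ζ) = (A + ζ / (1 - ζ) 𝟙 bᵀ)⁻¹`. -/
def symbol (ζ : ℂ) : Matrix (Fin (m + 1)) (Fin (m + 1)) ℂ :=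
  (R.AC + (ζ / (1 - ζ)) • Matrix.vecMulVec (fun _ => 1) R.bC)⁻¹

/-- `E_n(z)`: the `n`-th Taylor coefficient at `ζ = 0` of the matrix function
`(Δ(ζ) - z I)⁻¹ = ∑ E_n(z) ζⁿ`, taken entrywise. -/
def E (n : ℕ) (z : ℂ) : Matrix (Fin (m + 1)) (Fin (m + 1)) ℂ :=
  Matrix.of fun i k => iteratedDeriv n (fun ζ : ℂ => (R.symbol ζ - z • 1)⁻¹ i k) 0 / (n.factorial : ℂ)

/-- `e_n(z)`: the last row of `E_n(z)`. -/
def e (n : ℕ) (z : ℂ) : Fin (m + 1) → ℂ := R.E n z (Fin.last m)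

/-- The assumptions on the Runge-Kutta method. -/
structure Admissible : Prop where
  /-- A-stability, first half: the stage equations are solvable in the closed left half-plane. -/
  isUnit_of_re_nonpos : ∀ z : ℂ, z.re ≤ 0 → IsUnit (1 - z • R.AC)
  /-- A-stability, second half. -/
  norm_stab_le : ∀ z : ℂ, z.re ≤ 0 → ‖R.stab z‖ ≤ 1
  /-- The classical order is at least one. -/
  sum_b : ∑ i, R.b i = 1
  norm_stab_imag_lt : ∀ y : ℝ, y ≠ 0 → ‖R.stab (Complex.I * y)‖ < 1
  isUnit_A : IsUnit R.A
  /-- Stiff accuracy, `bᵀ A⁻¹ = (0, …, 0, 1)`. -/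
  stiffly_accurate : Matrix.vecMul R.b R.A⁻¹ = Pi.single (Fin.last m) 1

/-- `γ(ξ) = inf { log |r(z)| / Re z : -ξ ≤ Re z < 0 }`. Zeros of `r`, where the quotient is `+∞`,
do not contribute to the infimum and are left out. -/
def gamma (ξ : ℝ) : ℝ :=
  sInf {t : ℝ | ∃ z : ℂ, -ξ ≤ z.re ∧ z.re < 0 ∧ R.stab z ≠ 0 ∧ t = Real.log ‖R.stab z‖ / z.re}

/-- The set of values `‖q(z)‖`, `Re z ≤ 0`, for the norm `N` on row vectors. -/
def qNorms (N : Seminorm ℂ (Fin (m + 1) → ℂ)) : Set ℝ :=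
  (fun z : ℂ => N (R.q z)) '' {z : ℂ | z.re ≤ 0}

end RungeKutta

/-! ### The kernel and the integrals `I_{n,j}` in one space dimension -/

/-- `K(λ e^{i phi}, x) = exp(-|x| s) / (2 s)`, where `s = e^{-iπ/4} √λ e^{i phi/2}` is the value of
`√(z / i)` at `z = λ e^{i phi}`. For `|phi| < π` this is the principal branch, for `phi = ± π` its
continuation onto the two sides of the cut `(-∞, 0]`. -/
def kernelPolar (lam phi x : ℝ) : ℂ :=
  let s : ℂ := Complex.exp (-(Real.pi / 4) * Complex.I) * (Real.sqrt lam : ℂ) *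
    Complex.exp (phi / 2 * Complex.I)
  1 / (2 * s) * Complex.exp (-(|x| : ℝ) * s)

/-- The jump `G(λ, x) = K(λ e^{-iπ}, x) - K(λ e^{iπ}, x)`. -/
def G (lam x : ℝ) : ℂ := kernelPolar lam (-Real.pi) x - kernelPolar lam Real.pi x

/-- The endpoints `L_j`, with `L_j = (1 + B) L_{j-1}` for `j ≥ 1`. -/
def endpoint (B L₀ : ℝ) : ℕ → ℝ
  | 0 => L₀
  | j + 1 => (1 + B) * endpoint B L₀ j

/-- The integrand `h / (2 π i) G(λ, x) e_n(-h λ)`. -/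
def integrand {m : ℕ} (R : RungeKutta m) (h x : ℝ) (n : ℕ) (lam : ℝ) : Fin (m + 1) → ℂ :=
  ((h : ℂ) / (2 * Real.pi * Complex.I) * G lam x) • R.e n (-(h * lam : ℝ))

/-- The error on `[a, b]` of the Gauss-Legendre rule, carried over from `[-1, 1]` by the affine map
`y ↦ a + (b - a) / 2 * (y + 1)`. -/
def gaussError {m Q : ℕ} (g : GaussLegendreRule Q) (F : ℝ → Fin (m + 1) → ℂ) (a b : ℝ) :
    Fin (m + 1) → ℂ :=
  (∫ lam in a..b, F lam) -
    ∑ k, ((((b - a) / 2 * g.weight k : ℝ)) : ℂ) • F (a + (b - a) / 2 * (g.node k + 1))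

/-- The error `τ_{n,j}(Q)` in the approximation of `I_{n,j}`, `j ≥ 1`, by `Q`-node Gauss
quadrature. -/
def tau {m Q : ℕ} (R : RungeKutta m) (g : GaussLegendreRule Q) (h x B L₀ : ℝ) (n j : ℕ) :
    Fin (m + 1) → ℂ :=
  gaussError g (integrand R h x n) (endpoint B L₀ (j - 1)) (endpoint B L₀ j)

/-! ### The quantities in the bound -/

def rhoMax (B : ℝ) : ℝ := 1 + 2 / B * (1 + Real.sqrt (1 + B))

def etaPlus (B ρ : ℝ) : ℝ := 1 + B * ((ρ + ρ⁻¹) + 2) / 4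

def etaMinus (B ρ : ℝ) : ℝ := 1 + B * (-(ρ + ρ⁻¹) + 2) / 4

/-- The function of `ρ` that is minimized; `L` stands for `L_{j-1}`, `d` for `|x|`, `t` for `t_n`. -/
def boundFun {m : ℕ} (R : RungeKutta m) (Q : ℕ) (h d t B L ρ : ℝ) : ℝ :=
  ρ ^ (-2 * (Q : ℤ) + 1) / (ρ - 1) * (etaMinus B ρ) ^ (-(1 / 2) : ℝ) *
    Real.exp (d * L ^ (1 / 2 : ℝ) * (1 + (ρ / 2) ^ 2) ^ (1 / 4 : ℝ) * (etaPlus B ρ) ^ (1 / 2 : ℝ)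
      - L * t * R.gamma (h * L * etaPlus B ρ) * etaMinus B ρ)

end SchrodingerCQ

end

namespace SchrodingerCQ

/-! ### The error of Gauss-Legendre quadrature for analytic functions -/

namespace GaussLegendreRule

variable {Q : ℕ} (g : GaussLegendreRule Q)

/-! By stiff accuracy `e_n(z) = r(z)^n q(z)` in closed form (`e_eq`), so the integrand continues
holomorphically from the positive axis to the right half-plane: `G` becomes an explicit function of
one branch of `√(iλ)`, and `-hλ` stays where `r` and `q` have no poles.

The classical ellipse argument then applies. In the Joukowski variable, holomorphy on the closed
Bernstein ellipse of parameter `ρ` makes the Chebyshev coefficients decay like `ρ^(-k)`. A Gauss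
rule is exact below degree `2Q` and has nonnegative weights, so it sees only the tail of the
expansion (`GaussLegendreRule.norm_error_le`). Carried over to `[L, (1+B)L]`, the ellipse has real
parts in `[L η₋, L η₊]`; `ρ < ρ_max` says exactly that it stays right of `0`. There `|r|^n` is
controlled by `γ`, `q` by its supremum, and the jump by `|λ|`, which gives the bound for each `ρ`
(`seminorm_tau_le`).

Attainment is a separate matter, because `γ` need not be continuous. It is upper semicontinuous,
hence the bound is lower semicontinuous in `ρ`; since the bound blows up at both ends of `(1,
ρ_max)`, it has a minimizer (`exists_isLeast_boundFun`). -/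

theorem weight_nonneg (k : Fin Q) : 0 ≤ g.weight k := by
  set ℓ := Lagrange.basis Finset.univ g.node k
  have hinj : Set.InjOn g.node (Finset.univ : Finset (Fin Q)) := g.node_injective.injOn
  have hdeg : ℓ.natDegree ≤ Q - 1 := by
    have := Lagrange.degree_basis hinj (Finset.mem_univ k)
    rw [Finset.card_univ, Fintype.card_fin] at this
    exact (Polynomial.natDegree_eq_of_degree_eq_some this).le
  have hQ : 0 < Q := k.pos
  -- The square of a Lagrange basis polynomial has degree at most `2Q - 2`, is nonnegative, and
  -- picks out the single weight `k`.
  have h := g.exact (ℓ * ℓ) (by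
    have := Polynomial.natDegree_mul_le (p := ℓ) (q := ℓ)
    omega)
  rw [Finset.sum_eq_single k] at h
  · rw [Polynomial.eval_mul, Lagrange.eval_basis_self hinj (Finset.mem_univ k)] at h
    rw [mul_one, mul_one] at h
    rw [h]
    refine intervalIntegral.integral_nonneg (by norm_num) fun x _ => ?_
    rw [Polynomial.eval_mul]
    exact mul_self_nonneg _
  · intro i _ hi
    rw [Polynomial.eval_mul, Lagrange.eval_basis_of_ne hi.symm (Finset.mem_univ i)]
    ring
  · simp

theorem sum_weight (hQ : 1 ≤ Q) : ∑ k, g.weight k = 2 := by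
  have h := g.exact 1 (by rw [Polynomial.natDegree_one]; omega)
  simp only [Polynomial.eval_one, mul_one] at h
  rw [h]
  norm_num

/-- Gauss quadrature is as good as the best uniform approximation by polynomials of degree less
than `2 Q`. -/
theorem norm_error_le_of_approx (hQ : 1 ≤ Q) {φ : ℝ → ℂ} (hφ : ContinuousOn φ (Set.Icc (-1) 1))
    (a : ℕ → ℂ) (T : ℕ → ℝ[X]) (hT : ∀ k < 2 * Q, (T k).natDegree < 2 * Q) {ε : ℝ}
    (hε : ∀ x ∈ Set.Icc (-1 : ℝ) 1,
      ‖φ x - ∑ k ∈ Finset.range (2 * Q), a k * (((T k).eval x : ℝ) : ℂ)‖ ≤ ε) :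
    ‖(∫ x in (-1 : ℝ)..1, φ x) - ∑ k, (g.weight k : ℂ) * φ (g.node k)‖ ≤ 4 * ε := by
  set p : ℝ → ℂ := fun x => ∑ k ∈ Finset.range (2 * Q), a k * (((T k).eval x : ℝ) : ℂ) with hp
  have hpc : Continuous p := continuous_finsetSum _ fun k _ =>
    continuous_const.mul (Complex.continuous_ofReal.comp (T k).continuous)
  have hpi : IntervalIntegrable p MeasureTheory.volume (-1) 1 := hpc.intervalIntegrable _ _
  have hφi : IntervalIntegrable φ MeasureTheory.volume (-1) 1 :=
    ContinuousOn.intervalIntegrable (by rwa [Set.uIcc_of_le (by norm_num)])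
  have hexact : (∫ x in (-1 : ℝ)..1, p x) = ∑ k, (g.weight k : ℂ) * p (g.node k) := by
    simp only [hp]
    rw [intervalIntegral.integral_finsetSum fun k _ =>
      Continuous.intervalIntegrable (u := fun x : ℝ => a k * (((T k).eval x : ℝ) : ℂ))
        (continuous_const.mul (Complex.continuous_ofReal.comp (T k).continuous)) _ _]
    simp only [Finset.mul_sum]
    rw [Finset.sum_comm]
    refine Finset.sum_congr rfl fun k hk => ?_
    rw [intervalIntegral.integral_const_mul, intervalIntegral.integral_ofReal,
      ← g.exact (T k) (hT k (Finset.mem_range.1 hk)), Complex.ofReal_sum, Finset.mul_sum]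
    refine Finset.sum_congr rfl fun i _ => ?_
    push_cast
    ring
  have hsplit : (∫ x in (-1 : ℝ)..1, φ x) - ∑ k, (g.weight k : ℂ) * φ (g.node k) =
      (∫ x in (-1 : ℝ)..1, (φ x - p x)) -
        ∑ k, (g.weight k : ℂ) * (φ (g.node k) - p (g.node k)) := by
    rw [intervalIntegral.integral_sub hφi hpi, hexact]
    simp only [mul_sub, Finset.sum_sub_distrib]
    ring
  -- The constant 4 is the length 2 of the interval plus the total weight 2; nonnegativity of the
  -- weights keeps the sum of their absolute values at 2.
  have h1 : ‖∫ x in (-1 : ℝ)..1, (φ x - p x)‖ ≤ ε * |1 - (-1)| :=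
    intervalIntegral.norm_integral_le_of_norm_le_const fun x hx => by
      rw [Set.uIoc_of_le (by norm_num)] at hx
      exact hε x ⟨hx.1.le, hx.2⟩
  have h2 : ‖∑ k, (g.weight k : ℂ) * (φ (g.node k) - p (g.node k))‖ ≤ 2 * ε := by
    rw [← g.sum_weight hQ, Finset.sum_mul]
    refine norm_sum_le_of_le _ fun k _ => ?_
    rw [norm_mul, Complex.norm_real, Real.norm_of_nonneg (g.weight_nonneg k)]
    exact mul_le_mul_of_nonneg_left (hε _ (g.node_mem k)) (g.weight_nonneg k)
  rw [hsplit]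
  refine (norm_sub_le _ _).trans ?_
  norm_num at h1
  linarith

end GaussLegendreRule

/-- The Joukowski map `u ↦ (u + u⁻¹) / 2`. -/
noncomputable def joukowski (u : ℂ) : ℂ := (u + u⁻¹) / 2

theorem joukowski_inv (u : ℂ) : joukowski u⁻¹ = joukowski u := by
  simp [joukowski, add_comm]

theorem joukowski_exp (θ : ℝ) : joukowski (Complex.exp (θ * Complex.I)) = (Real.cos θ : ℝ) := by
  rw [joukowski, ← Complex.exp_neg, Complex.ofReal_cos, Complex.cos, neg_mul]

theorem differentiableAt_joukowski {u : ℂ} (hu : u ≠ 0) : DifferentiableAt ℂ joukowski u :=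
  (differentiableAt_id.add (differentiableAt_inv hu)).div_const 2

/-! ### Chebyshev coefficients of functions holomorphic on a Bernstein ellipse -/

section Chebyshev

variable {f : ℂ → ℂ} {ρ M : ℝ}

/-- The Laurent coefficients of `f ∘ joukowski`, computed on the circle of radius `ρ`. -/
theorem norm_circleIntegral_joukowski_le (hρ : 1 < ρ)
    (hf : ∀ u : ℂ, 1 ≤ ‖u‖ → ‖u‖ ≤ ρ → DifferentiableAt ℂ f (joukowski u))
    (hM : ∀ u : ℂ, ‖u‖ = ρ → ‖f (joukowski u)‖ ≤ M) (k : ℕ) :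
    ‖∮ u in C(0, 1), u⁻¹ • ((u ^ k)⁻¹ * f (joukowski u))‖ ≤ 2 * Real.pi * (M * (ρ ^ k)⁻¹) := by
  have hρ0 : 0 < ρ := by linarith
  have hd : ∀ u : ℂ, 1 ≤ ‖u‖ → ‖u‖ ≤ ρ →
      DifferentiableAt ℂ (fun u : ℂ => (u ^ k)⁻¹ * f (joukowski u)) u := by
    intro u h1 h2
    have hu : u ≠ 0 := by
      rintro rfl
      norm_num at h1
    exact ((differentiableAt_id.pow k).inv (pow_ne_zero k hu)).mul
      ((hf u h1 h2).comp u (differentiableAt_joukowski hu))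
  -- Cauchy's theorem on the annulus moves the contour from the unit circle out to radius `ρ`, where
  -- `u^(-k)` supplies the decay.
  have h := Complex.circleIntegral_sub_center_inv_smul_eq_of_differentiable_on_annulus_off_countable
    (c := 0) (r := 1) (R := ρ) one_pos hρ.le
    (f := fun u : ℂ => (u ^ k)⁻¹ * f (joukowski u)) (s := ∅) Set.countable_empty
    (fun u hu => (hd u (by simpa using hu.2) (by simpa using hu.1)).continuousAt.continuousWithinAt)
    (fun u hu => hd u (by simpa using (not_le.1 (by simpa using hu.1.2)).le)
      (by simpa using (mem_ball_zero_iff.1 hu.1.1).le))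
  simp only [sub_zero] at h
  rw [← h]
  refine (circleIntegral.norm_integral_le_of_norm_le_const (C := ρ⁻¹ * (M * (ρ ^ k)⁻¹))
    hρ0.le fun u hu => ?_).trans (le_of_eq (by field_simp))
  have hu' : ‖u‖ = ρ := by simpa using hu
  rw [smul_eq_mul, norm_mul, norm_mul, norm_inv, norm_inv, norm_pow, hu', mul_comm M]
  gcongr
  exact hM u hu'

/-- On the unit circle `f ∘ joukowski` is invariant under `u ↦ u⁻¹`, so its Fourier coefficients are
even and its Fourier series folds into a cosine series. The contour shift to radius `ρ` makes the
coefficients summable, which gives convergence at every point. -/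
theorem exists_chebyshev_expansion (hρ : 1 < ρ)
    (hf : ∀ u : ℂ, 1 ≤ ‖u‖ → ‖u‖ ≤ ρ → DifferentiableAt ℂ f (joukowski u))
    (hM : ∀ u : ℂ, ‖u‖ = ρ → ‖f (joukowski u)‖ ≤ M) :
    ∃ a : ℕ → ℂ, (∀ k, ‖a k‖ ≤ 2 * M * (ρ ^ k)⁻¹) ∧
      ∀ θ : ℝ, HasSum (fun k : ℕ => a k * (Real.cos (k * θ) : ℝ)) (f (Real.cos θ : ℝ)) := by
  have hρ0 : 0 < ρ := by linarith
  have : Fact (0 < 2 * Real.pi) := ⟨Real.two_pi_pos⟩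
  have hM0 : 0 ≤ M := (norm_nonneg _).trans (hM ρ (by simp [abs_of_pos hρ0]))
  let F : C(AddCircle (2 * Real.pi), ℂ) :=
    { toFun := fun x => f (joukowski (AddCircle.toCircle x))
      continuous_toFun := by
        rw [continuous_iff_continuousAt]
        intro x
        have hn : ‖(AddCircle.toCircle x : ℂ)‖ = 1 := Circle.norm_coe _
        have h1 := (hf (AddCircle.toCircle x) hn.ge (hn.le.trans hρ.le)).continuousAt
        have h2 : ContinuousAt (fun y : AddCircle (2 * Real.pi) => (AddCircle.toCircle y : ℂ)) x :=
          (continuous_subtype_val.comp AddCircle.continuous_toCircle).continuousAt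
        have h3 := (differentiableAt_joukowski (u := (AddCircle.toCircle x : ℂ))
          (Circle.coe_ne_zero _)).continuousAt
        exact ContinuousAt.comp (f := fun y : AddCircle (2 * Real.pi) =>
          joukowski (AddCircle.toCircle y)) h1 (ContinuousAt.comp (f := fun y :
            AddCircle (2 * Real.pi) => (AddCircle.toCircle y : ℂ)) h3 h2) }
  have htc : ∀ θ : ℝ, (AddCircle.toCircle (θ : AddCircle (2 * Real.pi)) : ℂ) =
      Complex.exp (θ * Complex.I) := by
    intro θ
    rw [AddCircle.toCircle_apply_mk, Circle.coe_exp]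
    congr 2
    field_simp
  have hFθ : ∀ θ : ℝ, F (θ : AddCircle (2 * Real.pi)) = f (Real.cos θ : ℝ) := by
    intro θ
    change f (joukowski (AddCircle.toCircle (θ : AddCircle (2 * Real.pi)))) = _
    rw [htc, joukowski_exp]
  have hfour : ∀ (n : ℤ) (θ : ℝ), (fourier n (θ : AddCircle (2 * Real.pi)) : ℂ) =
      Complex.exp (θ * Complex.I) ^ n := by
    intro n θ
    rw [fourier_coe_apply, ← Complex.exp_int_mul]
    congr 1
    have : (Real.pi : ℂ) ≠ 0 := by exact_mod_cast Real.pi_ne_zero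
    push_cast
    field_simp
  have hneg : ∀ n : ℤ, fourierCoeff F (-n) = fourierCoeff F n := by
    intro n
    unfold fourierCoeff
    rw [← MeasureTheory.integral_neg_eq_self]
    refine MeasureTheory.integral_congr_ae (Filter.Eventually.of_forall fun x => ?_)
    have : F (-x) = F x := by
      change f (joukowski (AddCircle.toCircle (-x))) = f (joukowski (AddCircle.toCircle x))
      rw [AddCircle.toCircle_neg, Circle.coe_inv, joukowski_inv]
    simp only [this]
    rw [fourier_apply, fourier_apply]
    simp
  have hcoeff : ∀ k : ℕ, ‖fourierCoeff F k‖ ≤ M * (ρ ^ k)⁻¹ := by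
    intro k
    have hint : (∫ θ in (0 : ℝ)..(2 * Real.pi), (fourier (-(k : ℤ)))
        (θ : AddCircle (2 * Real.pi)) • F (θ : AddCircle (2 * Real.pi))) =
        Complex.I⁻¹ * ∮ u in C(0, 1), u⁻¹ • ((u ^ k)⁻¹ * f (joukowski u)) := by
      rw [circleIntegral, ← intervalIntegral.integral_const_mul]
      refine intervalIntegral.integral_congr fun θ _ => ?_
      have hne := Complex.exp_ne_zero (θ * Complex.I)
      simp only [hfour, hFθ, deriv_circleMap, circleMap_zero, Complex.ofReal_one, one_mul,
        smul_eq_mul, joukowski_exp, zpow_neg, zpow_natCast]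
      have hI := Complex.I_ne_zero
      field_simp
    have h := norm_circleIntegral_joukowski_le hρ hf hM k
    rw [fourierCoeff_eq_intervalIntegral F k 0, zero_add, hint, norm_smul, norm_mul, norm_inv,
      Complex.norm_I, inv_one, one_mul, Real.norm_of_nonneg (by positivity)]
    calc 1 / (2 * Real.pi) * _ ≤ 1 / (2 * Real.pi) * (2 * Real.pi * (M * (ρ ^ k)⁻¹)) := by gcongr
      _ = _ := by field_simp
  have hgeo : Summable fun k : ℕ => M * (ρ ^ k)⁻¹ := by
    simp only [← inv_pow]
    exact (summable_geometric_of_lt_one (by positivity) (inv_lt_one_of_one_lt₀ hρ)).mul_left M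
  have hsumm : Summable (fourierCoeff F) := by
    refine Summable.of_nat_of_neg (Summable.of_norm_bounded hgeo hcoeff)
      (Summable.of_norm_bounded hgeo fun k => ?_)
    rw [hneg]
    exact hcoeff k
  refine ⟨fun k => if k = 0 then fourierCoeff F 0 else 2 * fourierCoeff F k, fun k => ?_,
    fun θ => ?_⟩
  · dsimp only
    split_ifs with hk
    · subst hk
      have := hcoeff 0
      push_cast at this
      have h0 : 0 ≤ M * (ρ ^ 0)⁻¹ := by positivity
      linarith
    · rw [norm_mul, Complex.norm_ofNat]
      linarith [hcoeff k]
  · have h := (has_pointwise_sum_fourier_series_of_summable hsumm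
      (θ : AddCircle (2 * Real.pi))).nat_add_neg
    -- Pairing `k` with `-k` counts the constant term twice; one copy is removed.
    have h0 : HasSum (fun k : ℕ => if k = 0 then fourierCoeff F 0 else 0) (fourierCoeff F 0) :=
      hasSum_ite_eq 0 _
    have h1 := h.sub h0
    rw [hFθ] at h1
    have hcos : ∀ k : ℕ, Complex.exp (θ * Complex.I) ^ (k : ℤ) +
        Complex.exp (θ * Complex.I) ^ (-(k : ℤ)) = 2 * (Real.cos (k * θ) : ℝ) := by
      intro k
      rw [← Complex.exp_int_mul, ← Complex.exp_int_mul, Complex.ofReal_cos, Complex.cos]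
      push_cast
      rw [show -(k : ℂ) * (θ * Complex.I) = -(k * θ) * Complex.I by ring,
        show (k : ℂ) * (θ * Complex.I) = (k * θ) * Complex.I by ring]
      ring
    have hterm : ∀ k : ℕ, fourierCoeff F k • fourier k (θ : AddCircle (2 * Real.pi)) +
        fourierCoeff F (-k) • fourier (-k) (θ : AddCircle (2 * Real.pi)) -
          (if k = 0 then fourierCoeff F 0 else 0) =
        (if k = 0 then fourierCoeff F 0 else 2 * fourierCoeff F k) * (Real.cos (k * θ) : ℝ) := by
      intro k
      rw [hneg, ← smul_add, hfour, hfour, hcos, smul_eq_mul]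
      split_ifs with hk
      · subst hk
        simp
        ring
      · ring
    simp only [hterm] at h1
    rwa [hfour, zpow_zero, smul_eq_mul, mul_one, add_sub_cancel_right] at h1

end Chebyshev

/-- The Chebyshev expansion cut after degree `2Q - 1` is the approximant. Its tail is at most `∑_{k
≥ 2Q} 2M ρ^(-k) = 2M ρ^(-2Q+1) / (ρ - 1)`, and the factor 4 of `norm_error_le_of_approx` gives 8. -/
theorem GaussLegendreRule.norm_error_le {Q : ℕ} (g : GaussLegendreRule Q) (hQ : 1 ≤ Q)
    {f : ℂ → ℂ} {ρ M : ℝ} (hρ : 1 < ρ)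
    (hf : ∀ u : ℂ, 1 ≤ ‖u‖ → ‖u‖ ≤ ρ → DifferentiableAt ℂ f (joukowski u))
    (hM : ∀ u : ℂ, ‖u‖ = ρ → ‖f (joukowski u)‖ ≤ M) :
    ‖(∫ x in (-1 : ℝ)..1, f x) - ∑ k, (g.weight k : ℂ) * f (g.node k)‖ ≤
      8 * M * (ρ ^ (-2 * (Q : ℤ) + 1) / (ρ - 1)) := by
  have hρ0 : 0 < ρ := by linarith
  obtain ⟨a, ha, hsum⟩ := exists_chebyshev_expansion hρ hf hM
  have hcont : ContinuousOn (fun x : ℝ => f x) (Set.Icc (-1) 1) := by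
    intro x hx
    have hj : joukowski (Complex.exp (Real.arccos x * Complex.I)) = x := by
      rw [joukowski_exp, Real.cos_arccos hx.1 hx.2]
    have hn := Complex.norm_exp_ofReal_mul_I (Real.arccos x)
    have h1 := (hf _ hn.ge (hn.le.trans hρ.le)).continuousAt
    rw [hj] at h1
    exact (ContinuousAt.comp (f := fun x : ℝ => (x : ℂ)) h1
      Complex.continuous_ofReal.continuousAt).continuousWithinAt
  have hgeo : HasSum (fun k : ℕ => 2 * M * (ρ ^ (k + 2 * Q))⁻¹)
      (2 * M * (ρ ^ (-2 * (Q : ℤ) + 1) / (ρ - 1))) := by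
    have h1 := (hasSum_geometric_of_lt_one (r := ρ⁻¹) (by positivity)
      (inv_lt_one_of_one_lt₀ hρ)).mul_left (2 * M * (ρ ^ (2 * Q))⁻¹)
    have hterm : ∀ k : ℕ, 2 * M * (ρ ^ (2 * Q))⁻¹ * ρ⁻¹ ^ k = 2 * M * (ρ ^ (k + 2 * Q))⁻¹ := by
      intro k
      rw [pow_add, inv_pow, mul_inv]
      ring
    have h2 : ρ ^ (-2 * (Q : ℤ) + 1) = (ρ ^ (2 * Q))⁻¹ * ρ := by
      rw [zpow_add₀ hρ0.ne', zpow_one, neg_mul, zpow_neg]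
      norm_cast
    have hval : 2 * M * (ρ ^ (2 * Q))⁻¹ * (1 - ρ⁻¹)⁻¹ =
        2 * M * (ρ ^ (-2 * (Q : ℤ) + 1) / (ρ - 1)) := by
      rw [h2, show 1 - ρ⁻¹ = (ρ - 1) / ρ by field_simp, inv_div]
      ring
    simp only [hterm] at h1
    rwa [hval] at h1
  refine (g.norm_error_le_of_approx hQ hcont a (fun k => Polynomial.Chebyshev.T ℝ k)
    (fun k hk => by rwa [Polynomial.Chebyshev.natDegree_T, Int.natAbs_natCast])
    (ε := 2 * M * (ρ ^ (-2 * (Q : ℤ) + 1) / (ρ - 1))) fun x hx => ?_).trans (le_of_eq (by ring))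
  have h := (hasSum_nat_add_iff' (2 * Q)).2 (hsum (Real.arccos x))
  rw [Real.cos_arccos hx.1 hx.2] at h
  have hT : ∀ k : ℕ, ((Polynomial.Chebyshev.T ℝ k).eval x) = Real.cos (k * Real.arccos x) := by
    intro k
    have := Polynomial.Chebyshev.T_real_cos (Real.arccos x) k
    rw [Real.cos_arccos hx.1 hx.2] at this
    exact_mod_cast this
  simp only [hT]
  refine h.norm_le_of_bounded hgeo fun k => ?_
  rw [norm_mul, Complex.norm_real]
  calc _ ≤ ‖a (k + 2 * Q)‖ * 1 := by gcongr; exact Real.abs_cos_le_one _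
    _ ≤ _ := by rw [mul_one]; exact ha _

open Filter Topology

/-! ### Entrywise calculus of matrix inverses, by Cramer's formula -/

section MatrixCalculus

variable {n : Type*} [Fintype n] [DecidableEq n] {X : ℂ → Matrix n n ℂ} {z : ℂ}

theorem differentiableAt_det (h : ∀ i j, DifferentiableAt ℂ (fun w => X w i j) z) :
    DifferentiableAt ℂ (fun w => (X w).det) z := by
  simp only [Matrix.det_apply]
  exact DifferentiableAt.fun_sum fun σ _ =>
    (DifferentiableAt.fun_finsetProd fun i _ => h (σ i) i).const_smul _

theorem differentiableAt_inv_apply (h : ∀ i j, DifferentiableAt ℂ (fun w => X w i j) z)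
    (hu : IsUnit (X z)) (i k : n) : DifferentiableAt ℂ (fun w => (X w)⁻¹ i k) z := by
  simp only [Matrix.inv_def, Ring.inverse_eq_inv', Matrix.smul_apply, smul_eq_mul,
    Matrix.adjugate_apply]
  refine ((differentiableAt_det h).inv ((Matrix.isUnit_iff_isUnit_det _).1 hu).ne_zero).mul
    (differentiableAt_det fun i' j' => ?_)
  by_cases hi : i' = k
  · subst hi
    simp
  · simpa [Matrix.updateRow_ne hi] using h i' j'

theorem eventually_isUnit (h : ∀ i j, DifferentiableAt ℂ (fun w => X w i j) z)
    (hu : IsUnit (X z)) : ∀ᶠ w in 𝓝 z, IsUnit (X w) := by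
  simp only [Matrix.isUnit_iff_isUnit_det, isUnit_iff_ne_zero] at hu ⊢
  exact (differentiableAt_det h).continuousAt.eventually_ne hu

end MatrixCalculus

/-- The Taylor coefficients of `c / (1 - r ζ)`. -/
theorem iteratedDeriv_div_one_sub (r c : ℂ) {f : ℂ → ℂ}
    (hf : f =ᶠ[𝓝 0] fun ζ => c / (1 - ζ * r)) (n : ℕ) :
    iteratedDeriv n f 0 / (n.factorial : ℂ) = r ^ n * c := by
  have h1 : HasFPowerSeriesAt f
      (FormalMultilinearSeries.ofScalars ℂ fun n => r ^ n * c) 0 := by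
    rw [hasFPowerSeriesAt_iff]
    have hev : ∀ᶠ ζ : ℂ in 𝓝 0, ‖ζ * r‖ < 1 := by
      have : ContinuousAt (fun ζ : ℂ => ‖ζ * r‖) 0 := by fun_prop
      exact this.eventually_lt continuousAt_const (by simp)
    filter_upwards [hev, hf] with ζ h1 h2
    rw [zero_add, h2]
    have := (hasSum_geometric_of_norm_lt_one h1).mul_right c
    simp only [mul_pow, mul_assoc] at this
    simp only [FormalMultilinearSeries.coeff_ofScalars, smul_eq_mul]
    rwa [div_eq_inv_mul]
  -- The Taylor series and the geometric series represent the same germ, so their coefficients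
  -- agree.
  have h2 := h1.analyticAt.hasFPowerSeriesAt
  have h3 := congrArg (fun p => FormalMultilinearSeries.coeff p n)
    (h2.eq_formalMultilinearSeries h1)
  simpa only [FormalMultilinearSeries.coeff_ofScalars] using h3

/-! ### Stability function, last-row weights and the decay rate `γ` -/

namespace RungeKutta

variable {m : ℕ} {R : RungeKutta m}

theorem differentiableAt_inv_stage {z : ℂ} (hz : IsUnit (1 - z • R.AC)) (i k : Fin (m + 1)) :
    DifferentiableAt ℂ (fun w : ℂ => (1 - w • R.AC)⁻¹ i k) z := by
  refine differentiableAt_inv_apply (X := fun w : ℂ => 1 - w • R.AC) (fun i j => ?_) hz i k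
  simp only [Matrix.sub_apply, Matrix.smul_apply, smul_eq_mul]
  fun_prop

theorem differentiableAt_q {z : ℂ} (hz : IsUnit (1 - z • R.AC)) (k : Fin (m + 1)) :
    DifferentiableAt ℂ (fun w => R.q w k) z := by
  simp only [q, Matrix.vecMul, dotProduct]
  exact DifferentiableAt.fun_sum fun i _ => (differentiableAt_inv_stage hz i k).const_mul _

theorem stab_eq (z : ℂ) : R.stab z = 1 + z * dotProduct (R.q z) (fun _ => 1) := by
  rw [stab, q, Matrix.dotProduct_mulVec]

theorem differentiableAt_stab {z : ℂ} (hz : IsUnit (1 - z • R.AC)) :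
    DifferentiableAt ℂ R.stab z := by
  rw [funext (stab_eq (R := R))]
  simp only [dotProduct, mul_one]
  exact (differentiableAt_id.mul
    (DifferentiableAt.fun_sum fun k _ => differentiableAt_q hz k)).const_add 1

theorem stab_zero : R.stab 0 = 1 := by simp [stab]

namespace Admissible

theorem isUnit_AC (hR : R.Admissible) : IsUnit R.AC :=
  hR.isUnit_A.map (Complex.ofRealHom.mapMatrix : Matrix (Fin (m + 1)) (Fin (m + 1)) ℝ →+* _)

/-- Multiplying `bᵀ A⁻¹ = (0, …, 0, 1)` by `A`: stiff accuracy makes `bᵀ` the last row of `A`. -/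
theorem bC_eq (hR : R.Admissible) : Matrix.vecMul (Pi.single (Fin.last m) 1) R.AC = R.bC := by
  have h : R.b = R.A (Fin.last m) := by
    have h1 := congrArg (fun v => Matrix.vecMul v R.A) hR.stiffly_accurate
    simp only [Matrix.vecMul_vecMul] at h1
    rw [Matrix.nonsing_inv_mul _ ((Matrix.isUnit_iff_isUnit_det _).1 hR.isUnit_A),
      Matrix.vecMul_one, Matrix.single_one_vecMul] at h1
    exact h1
  rw [Matrix.single_one_vecMul]
  funext k
  simp [bC, AC, h]

/-- Let `D = Δ(ζ)⁻¹` and let `e` be the last unit row vector. Then `e D = bᵀ / (1 - ζ)`, while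
`q(z)(I - zD) = bᵀ (1 - ζ r(z)) / (1 - ζ)` because `z q(z) 𝟙 = r(z) - 1`. Comparing the two, the
last row of `(Δ(ζ) - zI)⁻¹` is `q(z) / (1 - ζ r(z))`, a geometric series in `ζ`. -/
theorem e_eq (hR : R.Admissible) {z : ℂ} (hz : IsUnit (1 - z • R.AC)) (n : ℕ) (k : Fin (m + 1)) :
    R.e n z k = R.stab z ^ n * R.q z k := by
  set D : ℂ → Matrix (Fin (m + 1)) (Fin (m + 1)) ℂ := fun ζ =>
    R.AC + (ζ / (1 - ζ)) • Matrix.vecMulVec (fun _ => 1) R.bC with hD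
  have hDd : ∀ i j, DifferentiableAt ℂ (fun ζ => D ζ i j) 0 := fun i j => by
    simp only [hD, Matrix.add_apply, Matrix.smul_apply, smul_eq_mul]
    exact ((differentiableAt_id.div (differentiableAt_id.const_sub 1) (by simp)).mul_const
      _).const_add _
  have hev1 : ∀ᶠ ζ in 𝓝 (0 : ℂ), IsUnit (D ζ) :=
    eventually_isUnit hDd (by simpa [hD] using hR.isUnit_AC)
  have hev2 : ∀ᶠ ζ in 𝓝 (0 : ℂ), IsUnit (1 - z • D ζ) := by
    refine eventually_isUnit (X := fun ζ => 1 - z • D ζ) (fun i j => ?_) (by simpa [hD] using hz)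
    simp only [Matrix.sub_apply, Matrix.smul_apply, smul_eq_mul]
    exact ((hDd i j).const_mul z).const_sub _
  have hev3 : ∀ᶠ ζ in 𝓝 (0 : ℂ), 1 - ζ ≠ 0 :=
    (continuousAt_const.sub continuousAt_id).eventually_ne (by simp)
  have hev4 : ∀ᶠ ζ in 𝓝 (0 : ℂ), 1 - ζ * R.stab z ≠ 0 :=
    (continuousAt_const.sub (continuousAt_id.mul continuousAt_const)).eventually_ne (by simp)
  refine iteratedDeriv_div_one_sub (R.stab z) (R.q z k) ?_ n
  filter_upwards [hev1, hev2, hev3, hev4] with ζ h1 h2 h3 h4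
  have hd1 := (Matrix.isUnit_iff_isUnit_det _).1 h1
  set e : Fin (m + 1) → ℂ := Pi.single (Fin.last m) 1 with he
  have hprod : R.symbol ζ - z • 1 = (1 - z • D ζ) * (D ζ)⁻¹ := by
    rw [sub_mul, one_mul, smul_mul_assoc, Matrix.mul_nonsing_inv _ hd1]
    rfl
  have hX : IsUnit (R.symbol ζ - z • (1 : Matrix (Fin (m + 1)) (Fin (m + 1)) ℂ)) := by
    rw [hprod]
    exact h2.mul (Matrix.isUnit_nonsing_inv_iff.2 h1)
  have hqA : Matrix.vecMul (R.q z) (1 - z • R.AC) = R.bC := by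
    rw [q, Matrix.vecMul_vecMul, Matrix.nonsing_inv_mul _ ((Matrix.isUnit_iff_isUnit_det _).1 hz),
      Matrix.vecMul_one]
  have hq1 : z * dotProduct (R.q z) (fun _ => 1) = R.stab z - 1 := by
    rw [stab_eq]
    ring
  have heD : Matrix.vecMul e (D ζ) = (1 - ζ)⁻¹ • R.bC := by
    rw [hD]
    simp only
    rw [Matrix.vecMul_add, hR.bC_eq, Matrix.vecMul_smul, Matrix.vecMul_vecMulVec]
    funext i
    simp [he]
    field_simp
    ring
  have hqD : Matrix.vecMul (R.q z) (1 - z • D ζ) = (1 - ζ * R.stab z) • Matrix.vecMul e (D ζ) := by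
    have : (1 - z • D ζ) = (1 - z • R.AC) -
        (z * (ζ / (1 - ζ))) • Matrix.vecMulVec (fun _ => 1) R.bC := by
      rw [hD]
      simp only
      rw [smul_add, smul_smul, sub_sub]
    rw [this, Matrix.vecMul_sub, hqA, Matrix.vecMul_smul, Matrix.vecMul_vecMulVec, heD]
    funext i
    simp only [Pi.sub_apply, Pi.smul_apply, smul_eq_mul]
    rw [show ∀ s : ℂ, z * (ζ / (1 - ζ)) * (s * R.bC i) = (z * s) * (ζ / (1 - ζ)) * R.bC i from
      fun s => by ring]
    have hq1' : z * (R.q z ⬝ᵥ fun _ => 1) = R.stab z - 1 := hq1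
    simp only [hq1']
    field_simp
    ring
  have hrow : Matrix.vecMul ((1 - ζ * R.stab z)⁻¹ • R.q z) (R.symbol ζ - z • 1) = e := by
    rw [hprod, ← Matrix.vecMul_vecMul, Matrix.smul_vecMul, hqD, smul_smul, inv_mul_cancel₀ h4,
      one_smul, Matrix.vecMul_vecMul, Matrix.mul_nonsing_inv _ hd1, Matrix.vecMul_one]
  have hrow' : (R.symbol ζ - z • 1)⁻¹ (Fin.last m) = (1 - ζ * R.stab z)⁻¹ • R.q z := by
    change Matrix.row _ _ = _
    rw [← Matrix.single_one_vecMul, ← he, ← hrow, Matrix.vecMul_vecMul,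
      Matrix.mul_nonsing_inv _ ((Matrix.isUnit_iff_isUnit_det _).1 hX), Matrix.vecMul_one]
  rw [hrow', Pi.smul_apply, smul_eq_mul, div_eq_inv_mul]

/-- Near infinity, `w = z⁻¹` turns `q(z)` into `w bᵀ (wI - A)⁻¹`, which is continuous and zero at `w
= 0` since `A` is invertible. The rest of the half-plane is compact, and `q` is continuous on it. -/
theorem exists_norm_q_apply_le (hR : R.Admissible) (k : Fin (m + 1)) : ∃ C : ℝ, ∀ z : ℂ, z.re ≤ 0 → ‖R.q z k‖ ≤ C := by
  set p : ℂ → ℂ := fun w => w * Matrix.vecMul R.bC (w • 1 - R.AC)⁻¹ k with hp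
  have hpc : ContinuousAt p 0 := by
    suffices h : DifferentiableAt ℂ p 0 from h.continuousAt
    simp only [hp, Matrix.vecMul, dotProduct]
    refine differentiableAt_fun_id.fun_mul (DifferentiableAt.fun_sum fun i _ =>
      (DifferentiableAt.const_mul ?_ _))
    refine differentiableAt_inv_apply (X := fun w : ℂ => w • 1 - R.AC) (fun i j => ?_)
      (by simpa using hR.isUnit_AC.neg) i k
    simp only [Matrix.sub_apply, Matrix.smul_apply, smul_eq_mul]
    fun_prop
  have hev : ∀ᶠ w in 𝓝 (0 : ℂ), ‖p w‖ < 1 :=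
    hpc.norm.eventually_lt continuousAt_const (by simp [hp])
  obtain ⟨δ, hδ, hball⟩ := Metric.eventually_nhds_iff.1 hev
  have hcompact : IsCompact (Metric.closedBall (0 : ℂ) δ⁻¹ ∩ {z | z.re ≤ 0}) :=
    (isCompact_closedBall _ _).inter_right (isClosed_le Complex.continuous_re continuous_const)
  obtain ⟨C, hC⟩ := hcompact.exists_bound_of_continuousOn (f := fun z => R.q z k) fun z hz =>
    (differentiableAt_q (hR.isUnit_of_re_nonpos z hz.2) k).continuousAt.continuousWithinAt
  refine ⟨max C 1, fun z hz => ?_⟩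
  by_cases hzδ : ‖z‖ ≤ δ⁻¹
  · exact (hC z ⟨by simpa using hzδ, hz⟩).trans (le_max_left _ _)
  · rw [not_le] at hzδ
    have hz0 : z ≠ 0 := by
      rintro rfl
      rw [norm_zero] at hzδ
      exact absurd hzδ (not_lt.2 (by positivity))
    have hlt : dist z⁻¹ 0 < δ := by
      rw [dist_zero_right, norm_inv]
      exact inv_lt_of_inv_lt₀ hδ hzδ
    have heq : R.q z k = p z⁻¹ := by
      have h1 : (1 - z • R.AC) = z • (z⁻¹ • 1 - R.AC) := by
        rw [smul_sub, smul_smul, mul_inv_cancel₀ hz0, one_smul]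
      have hu : IsUnit (z⁻¹ • 1 - R.AC).det := by
        have h2 := (Matrix.isUnit_iff_isUnit_det _).1 (hR.isUnit_of_re_nonpos z hz)
        rw [h1, Matrix.det_smul] at h2
        exact isUnit_of_mul_isUnit_right h2
      have h3 : (1 - z • R.AC)⁻¹ = z⁻¹ • (z⁻¹ • 1 - R.AC)⁻¹ := by
        rw [h1]
        refine Matrix.inv_eq_left_inv ?_
        rw [smul_mul_smul_comm, inv_mul_cancel₀ hz0, Matrix.nonsing_inv_mul _ hu, one_smul]
      rw [q, h3, Matrix.vecMul_smul, Pi.smul_apply, smul_eq_mul]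
    rw [heq]
    exact (hball hlt).le.trans (le_max_right _ _)

theorem bddAbove_qNorms (hR : R.Admissible) (N : Seminorm ℂ (Fin (m + 1) → ℂ)) : BddAbove (R.qNorms N) := by
  choose C hC using hR.exists_norm_q_apply_le
  refine ⟨∑ k, C k * N (Pi.single k 1), ?_⟩
  rintro _ ⟨z, hz, rfl⟩
  have h1 : R.q z = ∑ k, R.q z k • (Pi.single k 1 : Fin (m + 1) → ℂ) := by
    conv_lhs => rw [← Finset.univ_sum_single (R.q z)]
    refine Finset.sum_congr rfl fun k _ => ?_
    rw [← Pi.single_smul, smul_eq_mul, mul_one]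
  change N (R.q z) ≤ _
  rw [h1]
  refine (Finset.le_sum_of_subadditive N (map_zero N).le (map_add_le_add N) _ _).trans ?_
  refine Finset.sum_le_sum fun k _ => ?_
  rw [map_smul_eq_mul]
  exact mul_le_mul_of_nonneg_right (hC k z hz) (apply_nonneg N _)


theorem log_norm_stab_div_nonneg (hR : R.Admissible) {z : ℂ} (hz : z.re < 0) : 0 ≤ Real.log ‖R.stab z‖ / z.re :=
  div_nonneg_of_nonpos (Real.log_nonpos (norm_nonneg _) (hR.norm_stab_le z hz.le)) hz.le

theorem gamma_le (hR : R.Admissible) {ξ : ℝ} {z : ℂ} (h1 : -ξ ≤ z.re) (h2 : z.re < 0) (h3 : R.stab z ≠ 0) :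
    R.gamma ξ ≤ Real.log ‖R.stab z‖ / z.re := by
  refine csInf_le ⟨0, ?_⟩ ⟨z, h1, h2, h3, rfl⟩
  rintro _ ⟨w, -, hw, -, rfl⟩
  exact hR.log_norm_stab_div_nonneg hw

theorem gamma_nonneg (hR : R.Admissible) (ξ : ℝ) : 0 ≤ R.gamma ξ := by
  refine Real.sInf_nonneg ?_
  rintro _ ⟨w, -, hw, -, rfl⟩
  exact hR.log_norm_stab_div_nonneg hw

theorem continuousAt_stab (hR : R.Admissible) {z : ℂ} (hz : z.re ≤ 0) : ContinuousAt R.stab z :=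
  (differentiableAt_stab (hR.isUnit_of_re_nonpos z hz)).continuousAt

/-- Since `r(0) = 1`, small negative reals are not zeros of `r`. Without this, the real `sInf` of
the empty set would be `0` rather than `+∞`. -/
theorem gamma_set_nonempty (hR : R.Admissible) {ξ : ℝ} (hξ : 0 < ξ) :
    {t : ℝ | ∃ z : ℂ, -ξ ≤ z.re ∧ z.re < 0 ∧ R.stab z ≠ 0 ∧
      t = Real.log ‖R.stab z‖ / z.re}.Nonempty := by
  have hev : ∀ᶠ z in 𝓝 (0 : ℂ), R.stab z ≠ 0 :=
    (hR.continuousAt_stab le_rfl).eventually_ne (by rw [stab_zero]; exact one_ne_zero)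
  obtain ⟨δ, hδ, hball⟩ := Metric.eventually_nhds_iff.1 hev
  have hpos : 0 < min ξ (δ / 2) := by positivity
  refine ⟨_, ((-min ξ (δ / 2) : ℝ) : ℂ), ?_, ?_, hball ?_, rfl⟩
  · rw [Complex.ofReal_re]
    exact neg_le_neg (min_le_left _ _)
  · rw [Complex.ofReal_re]
    linarith
  · rw [dist_zero_right, Complex.norm_real, norm_neg, Real.norm_of_nonneg hpos.le]
    exact (min_le_right _ _).trans_lt (by linarith)

theorem gamma_anti (hR : R.Admissible) {ξ ξ' : ℝ} (hξ : 0 < ξ) (h : ξ ≤ ξ') : R.gamma ξ' ≤ R.gamma ξ := by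
  refine le_csInf (hR.gamma_set_nonempty hξ) ?_
  rintro _ ⟨z, h1, h2, h3, rfl⟩
  exact hR.gamma_le (by linarith) h2 h3

/-- Upper semicontinuity of `γ`. -/
theorem eventually_gamma_lt (hR : R.Admissible) {ξ t : ℝ} (hξ : 0 < ξ) (ht : R.gamma ξ < t) :
    ∀ᶠ ξ' in 𝓝 ξ, R.gamma ξ' < t := by
  obtain ⟨_, ⟨z, h1, h2, h3, rfl⟩, hlt⟩ := exists_lt_of_csInf_lt (hR.gamma_set_nonempty hξ) ht
  have hc := hR.continuousAt_stab h2.le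
  have hlog : ContinuousAt (fun w : ℂ => Real.log ‖R.stab w‖ / w.re) z :=
    (hc.norm.log (norm_ne_zero_iff.2 h3)).div Complex.continuous_re.continuousAt h2.ne
  -- The near-minimizer may lie on the line `Re z = -ξ`; moved slightly to the right, it remains
  -- admissible for `ξ'` slightly below `ξ`.
  have hshift : Tendsto (fun ε : ℝ => z + (ε : ℂ)) (𝓝 0) (𝓝 z) := by
    have : ContinuousAt (fun ε : ℝ => z + (ε : ℂ)) 0 := by fun_prop
    simpa [ContinuousAt] using this
  have hev : ∀ᶠ w in 𝓝 z, R.stab w ≠ 0 ∧ Real.log ‖R.stab w‖ / w.re < t ∧ w.re < 0 :=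
    (hc.eventually_ne h3).and ((hlog.eventually_lt continuousAt_const hlt).and
      (Complex.continuous_re.continuousAt.eventually_lt continuousAt_const h2))
  obtain ⟨ε, ⟨g1, g2, g3⟩, hε⟩ :=
    (((hshift.eventually hev).filter_mono nhdsWithin_le_nhds).and
      (self_mem_nhdsWithin : Set.Ioi (0 : ℝ) ∈ 𝓝[>] 0)).exists
  have hε' : 0 < ε := hε
  have hre : (z + (ε : ℂ)).re = z.re + ε := by simp
  filter_upwards [lt_mem_nhds (show -(z + (ε : ℂ)).re < ξ by rw [hre]; linarith)] with ξ' hξ'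
  exact (hR.gamma_le (by linarith) g3 g1).trans_lt g2

/-- Since `Re z < 0`, the definition of `γ` reads `log |r(z)| ≤ γ(ξ) Re z`; zeros of `r` satisfy the
bound trivially. -/
theorem norm_stab_pow_le (hR : R.Admissible) {ξ : ℝ} {z : ℂ} (h1 : -ξ ≤ z.re) (h2 : z.re < 0) (n : ℕ) :
    ‖R.stab z‖ ^ n ≤ Real.exp (n * (R.gamma ξ * z.re)) := by
  rw [Real.exp_nat_mul]
  refine pow_le_pow_left₀ (norm_nonneg _) ?_ n
  by_cases h3 : R.stab z = 0
  · rw [h3, norm_zero]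
    exact (Real.exp_pos _).le
  · rw [← Real.log_le_iff_le_exp (norm_pos_iff.2 h3)]
    exact (le_div_iff_of_neg h2).1 (hR.gamma_le h1 h2 h3)

end Admissible

end RungeKutta

/-! ### Attainment of the minimum -/

/-- Blow-up at both ends confines the values not exceeding `f c` to a compact subinterval, where
lower semicontinuity suffices for a minimum. -/
theorem exists_isMinOn_Ioo {f : ℝ → ℝ} {a b : ℝ} (hab : a < b)
    (hf : LowerSemicontinuousOn f (Set.Ioo a b))
    (ha : Tendsto f (𝓝[>] a) atTop) (hb : Tendsto f (𝓝[<] b) atTop) :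
    ∃ x ∈ Set.Ioo a b, IsMinOn f (Set.Ioo a b) x := by
  obtain ⟨c, hc⟩ := exists_between hab
  obtain ⟨a', ha', ha''⟩ := (mem_nhdsGT_iff_exists_Ioo_subset).1 (ha.eventually_gt_atTop (f c))
  obtain ⟨b', hb', hb''⟩ := (mem_nhdsLT_iff_exists_Ioo_subset).1 (hb.eventually_gt_atTop (f c))
  simp only [Set.mem_Ioi, Set.mem_Iio] at ha' hb'
  have hca : a' ≤ c := not_lt.1 fun h => lt_irrefl (f c) (ha'' (Set.mem_Ioo.2 ⟨hc.1, h⟩))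
  have hcb : c ≤ b' := not_lt.1 fun h => lt_irrefl (f c) (hb'' (Set.mem_Ioo.2 ⟨h, hc.2⟩))
  have hsub : Set.Icc a' b' ⊆ Set.Ioo a b := fun x hx =>
    ⟨ha'.trans_le hx.1, hx.2.trans_lt hb'⟩
  obtain ⟨x, hx, hmin⟩ := LowerSemicontinuousOn.exists_isMinOn
    (Set.nonempty_Icc.2 (hca.trans hcb)) isCompact_Icc (hf.mono hsub)
  refine ⟨x, hsub hx, fun y hy => ?_⟩
  have hxc : f x ≤ f c := hmin ⟨hca, hcb⟩
  rcases lt_or_ge y a' with h | h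
  · exact hxc.trans (ha'' ⟨hy.1, h⟩).le
  · rcases lt_or_ge b' y with h' | h'
    · exact hxc.trans (hb'' ⟨h', hy.2⟩).le
    · exact hmin ⟨h, h'⟩

/-! ### Elementary properties of `η₊`, `η₋` and `ρ_max` -/

section Eta

variable {B ρ : ℝ}

theorem add_inv_lt_add_inv {r s : ℝ} (hr : 1 ≤ r) (hrs : r < s) : r + r⁻¹ < s + s⁻¹ := by
  have hr0 : 0 < r := by linarith
  have hs0 : 0 < s := by linarith
  have h1 : 1 < r * s := by nlinarith
  have h : s + s⁻¹ - (r + r⁻¹) = (s - r) * (r * s - 1) / (r * s) := by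
    field_simp
    ring
  have : 0 < (s - r) * (r * s - 1) / (r * s) :=
    div_pos (mul_pos (by linarith) (by linarith)) (by positivity)
  linarith

theorem one_lt_rhoMax (hB : 0 < B) : 1 < rhoMax B := by
  have : 0 < 2 / B * (1 + Real.sqrt (1 + B)) := by positivity
  rw [rhoMax]
  linarith

/-- With `s = √(1 + B)` one has `ρ_max = (s + 1) / (s - 1)`, so `ρ_max + ρ_max⁻¹ = 2 + 4 / B`. At
this parameter the left vertex of the ellipse reaches the branch point `0`. -/
theorem etaMinus_rhoMax (hB : 0 < B) : etaMinus B (rhoMax B) = 0 := by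
  set s := Real.sqrt (1 + B) with hs
  have hs2 : s ^ 2 = 1 + B := Real.sq_sqrt (by linarith)
  have hs1 : 1 < s := by
    rw [hs, Real.lt_sqrt (by norm_num)]
    linarith
  have hBs : B = (s - 1) * (s + 1) := by linarith [show (s - 1) * (s + 1) = s ^ 2 - 1 by ring]
  have h1 : s - 1 ≠ 0 := by linarith
  have h2 : s + 1 ≠ 0 := by linarith
  have hr : rhoMax B = (s + 1) / (s - 1) := by
    rw [rhoMax, ← hs, hBs]
    field_simp
    ring
  rw [etaMinus, hr, inv_div, hBs]
  field_simp
  ring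

theorem etaMinus_pos (hB : 0 < B) (h1 : 1 ≤ ρ) (h2 : ρ < rhoMax B) : 0 < etaMinus B ρ := by
  rw [← etaMinus_rhoMax hB, etaMinus, etaMinus]
  have := mul_lt_mul_of_pos_left (add_inv_lt_add_inv h1 h2) hB
  linarith

theorem etaMinus_le_one (hB : 0 < B) (h1 : 1 < ρ) : etaMinus B ρ ≤ 1 := by
  have h := add_inv_lt_add_inv le_rfl h1
  have : 0 ≤ B * (ρ + ρ⁻¹ - 2) := mul_nonneg hB.le (by norm_num at h; linarith)
  rw [etaMinus]
  linarith

theorem one_le_etaPlus (hB : 0 < B) (h1 : 1 < ρ) : 1 ≤ etaPlus B ρ := by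
  have : 0 ≤ B * ((ρ + ρ⁻¹) + 2) / 4 := by
    have : 0 < ρ := by linarith
    positivity
  rw [etaPlus]
  linarith

theorem half_mul_le_etaPlus (hB : 0 < B) (h1 : 1 < ρ) : B / 2 ≤ etaPlus B ρ := by
  have : 0 ≤ B * (ρ + ρ⁻¹) := by
    have : 0 < ρ := by linarith
    positivity
  rw [etaPlus]
  linarith

theorem continuousAt_etaMinus (h : 0 < ρ) : ContinuousAt (etaMinus B) ρ := by
  unfold etaMinus
  have := h.ne'
  fun_prop (disch := assumption)

theorem continuousAt_etaPlus (h : 0 < ρ) : ContinuousAt (etaPlus B) ρ := by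
  unfold etaPlus
  have := h.ne'
  fun_prop (disch := assumption)

end Eta

/-! ### Lower semicontinuity and blow-up of the bound -/

section Minimum

variable {m : ℕ} {R : RungeKutta m} (Q : ℕ) {h d t B L : ℝ}

/-- The algebraic factor of `boundFun`. -/
noncomputable def boundPrefactor (B ρ : ℝ) : ℝ :=
  ρ ^ (-2 * (Q : ℤ) + 1) / (ρ - 1) * (etaMinus B ρ) ^ (-(1 / 2) : ℝ)

/-- The growth exponent in `boundFun`. -/
noncomputable def boundGrowth (d B L ρ : ℝ) : ℝ :=
  d * L ^ (1 / 2 : ℝ) * (1 + (ρ / 2) ^ 2) ^ (1 / 4 : ℝ) * (etaPlus B ρ) ^ (1 / 2 : ℝ)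

theorem boundFun_eq (ρ : ℝ) : boundFun R Q h d t B L ρ = boundPrefactor Q B ρ *
    Real.exp (boundGrowth d B L ρ - L * t * R.gamma (h * L * etaPlus B ρ) * etaMinus B ρ) := rfl

theorem boundPrefactor_pos (hB : 0 < B) {ρ : ℝ} (hρ : ρ ∈ Set.Ioo 1 (rhoMax B)) :
    0 < boundPrefactor Q B ρ :=
  mul_pos (div_pos (zpow_pos (by linarith [hρ.1]) _) (by linarith [hρ.1]))
    (Real.rpow_pos_of_pos (etaMinus_pos hB hρ.1.le hρ.2) _)

theorem continuousAt_boundPrefactor (hB : 0 < B) {ρ : ℝ} (hρ : ρ ∈ Set.Ioo 1 (rhoMax B)) :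
    ContinuousAt (boundPrefactor Q B) ρ := by
  have h0 : 0 < ρ := by linarith [hρ.1]
  exact ((continuousAt_id.zpow₀ _ (Or.inl h0.ne')).div (continuousAt_id.sub continuousAt_const)
    (sub_ne_zero.2 hρ.1.ne')).mul ((continuousAt_etaMinus h0).rpow_const
      (Or.inl (etaMinus_pos hB hρ.1.le hρ.2).ne'))

theorem continuousAt_boundGrowth {ρ : ℝ} (hρ : 0 < ρ) :
    ContinuousAt (boundGrowth d B L) ρ := by
  refine (ContinuousAt.mul continuousAt_const (ContinuousAt.rpow_const (by fun_prop)
    (Or.inr (by norm_num)))).mul ((continuousAt_etaPlus hρ).rpow_const (Or.inr (by norm_num)))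

theorem lowerSemicontinuousOn_boundFun (hR : R.Admissible) (hh : 0 < h) (ht : 0 ≤ t) (hB : 0 < B)
    (hL : 0 < L) :
    LowerSemicontinuousOn (boundFun R Q h d t B L) (Set.Ioo 1 (rhoMax B)) := by
  intro ρ hρ y hy
  have hρ0 : 0 < ρ := by linarith [hρ.1]
  refine Eventually.filter_mono nhdsWithin_le_nhds ?_
  -- Replacing `γ` by a free variable `s` makes the bound continuous in each variable and decreasing
  -- in `s`. A frozen `s` just above `γ` at the base point still gives a value above `y`, and by
  -- upper semicontinuity it dominates `γ` nearby.
  set H : ℝ → ℝ → ℝ := fun r s => boundPrefactor Q B r *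
    Real.exp (boundGrowth d B L r - L * t * s * etaMinus B r) with hH
  have hHs : Continuous (H ρ) := by
    simp only [hH]
    fun_prop
  have hHr : ∀ s, ContinuousAt (fun r => H r s) ρ := fun s =>
    (continuousAt_boundPrefactor Q hB hρ).mul (((continuousAt_boundGrowth hρ0).sub
      (continuousAt_const.mul (continuousAt_etaMinus hρ0))).rexp)
  have hξ : 0 < h * L * etaPlus B ρ :=
    mul_pos (mul_pos hh hL) (by linarith [one_le_etaPlus hB hρ.1])
  have hev : ∀ᶠ s in 𝓝 (R.gamma (h * L * etaPlus B ρ)), y < H ρ s :=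
    continuousAt_const.eventually_lt hHs.continuousAt hy
  obtain ⟨s, hs1, hs2⟩ := ((hev.filter_mono nhdsWithin_le_nhds).and
    (self_mem_nhdsWithin : Set.Ioi (R.gamma (h * L * etaPlus B ρ)) ∈ 𝓝[>] _)).exists
  have hev2 : ∀ᶠ r in 𝓝 ρ, R.gamma (h * L * etaPlus B r) < s :=
    (continuousAt_const.mul (continuousAt_etaPlus hρ0)).eventually
      (hR.eventually_gamma_lt hξ hs2)
  filter_upwards [hev2, (continuousAt_const.eventually_lt (hHr s) hs1), Ioo_mem_nhds hρ.1 hρ.2]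
    with r h1 h2 h3
  refine h2.trans_le ?_
  rw [boundFun_eq]
  have := (etaMinus_pos hB h3.1.le h3.2).le
  have := (boundPrefactor_pos Q hB h3).le
  simp only [hH]
  gcongr

/-- The exponential is bounded below independently of `ρ`: the growth term is nonnegative, `η₋ ≤ 1`,
and `γ` is antitone with `η₊ ≥ 1`. So only the prefactor matters for the blow-up. -/
theorem boundPrefactor_mul_le_boundFun (hR : R.Admissible) (hh : 0 < h) (hd : 0 ≤ d) (ht : 0 ≤ t)
    (hB : 0 < B) (hL : 0 < L) {ρ : ℝ} (hρ : ρ ∈ Set.Ioo 1 (rhoMax B)) :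
    boundPrefactor Q B ρ * Real.exp (-(L * t * R.gamma (h * L))) ≤ boundFun R Q h d t B L ρ := by
  rw [boundFun_eq]
  have hp := (boundPrefactor_pos Q hB hρ).le
  have h1 := one_le_etaPlus hB hρ.1
  have h2 := (etaMinus_pos hB hρ.1.le hρ.2).le
  have h3 := etaMinus_le_one hB hρ.1
  have hgrowth : 0 ≤ boundGrowth d B L ρ := by
    have : 0 ≤ etaPlus B ρ := by linarith
    unfold boundGrowth
    positivity
  have hγ := hR.gamma_anti (mul_pos hh hL) (ξ' := h * L * etaPlus B ρ)
    (le_mul_of_one_le_right (by positivity) h1)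
  have hγ0 := hR.gamma_nonneg (h * L)
  have hle : L * t * R.gamma (h * L * etaPlus B ρ) * etaMinus B ρ ≤ L * t * R.gamma (h * L) * 1 := by
    gcongr
  gcongr
  linarith

theorem tendsto_boundPrefactor_left (hB : 0 < B) :
    Tendsto (boundPrefactor Q B) (𝓝[>] 1) atTop := by
  have h1 : Tendsto (fun ρ : ℝ => (ρ - 1)⁻¹) (𝓝[>] 1) atTop := by
    refine tendsto_inv_nhdsGT_zero.comp (tendsto_nhdsWithin_iff.2 ⟨?_, ?_⟩)
    · have : ContinuousAt (fun ρ : ℝ => ρ - 1) 1 := by fun_prop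
      simpa [ContinuousAt] using this.tendsto.mono_left nhdsWithin_le_nhds
    · filter_upwards [self_mem_nhdsWithin] with ρ hρ
      exact sub_pos.2 (Set.mem_Ioi.1 hρ)
  have h2 : ContinuousAt (fun ρ : ℝ => ρ ^ (-2 * (Q : ℤ) + 1) * (etaMinus B ρ) ^ (-(1 / 2) : ℝ)) 1 :=
    (continuousAt_id.zpow₀ _ (Or.inl one_ne_zero)).mul ((continuousAt_etaMinus one_pos).rpow_const
      (Or.inl (etaMinus_pos hB le_rfl (one_lt_rhoMax hB)).ne'))
  refine (h1.atTop_mul_pos (mul_pos (zpow_pos one_pos _) (Real.rpow_pos_of_pos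
    (etaMinus_pos hB le_rfl (one_lt_rhoMax hB)) _))
    (h2.tendsto.mono_left nhdsWithin_le_nhds)).congr fun ρ => ?_
  rw [boundPrefactor]
  ring

theorem tendsto_boundPrefactor_right (hB : 0 < B) :
    Tendsto (boundPrefactor Q B) (𝓝[<] rhoMax B) atTop := by
  have hr := one_lt_rhoMax hB
  have h0 : 0 < rhoMax B := by linarith
  have h1 : Tendsto (fun ρ : ℝ => (etaMinus B ρ) ^ (-(1 / 2) : ℝ)) (𝓝[<] rhoMax B) atTop := by
    have h2 : Tendsto (etaMinus B) (𝓝[<] rhoMax B) (𝓝[>] 0) := by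
      refine tendsto_nhdsWithin_iff.2 ⟨?_, ?_⟩
      · have := (continuousAt_etaMinus (B := B) h0).tendsto
        rw [etaMinus_rhoMax hB] at this
        exact this.mono_left nhdsWithin_le_nhds
      · filter_upwards [Ioo_mem_nhdsLT hr] with ρ hρ
        exact etaMinus_pos hB hρ.1.le hρ.2
    have h3 := (tendsto_rpow_atTop (y := 1 / 2) (by norm_num)).comp (tendsto_inv_nhdsGT_zero.comp h2)
    refine h3.congr' ?_
    filter_upwards [Ioo_mem_nhdsLT hr] with ρ hρ
    have := (etaMinus_pos hB hρ.1.le hρ.2).le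
    rw [Real.rpow_neg this, Function.comp_apply, Function.comp_apply, Real.inv_rpow this]
  have h2 : ContinuousAt (fun ρ : ℝ => ρ ^ (-2 * (Q : ℤ) + 1) / (ρ - 1)) (rhoMax B) :=
    (continuousAt_id.zpow₀ _ (Or.inl h0.ne')).div (continuousAt_id.sub continuousAt_const)
      (sub_ne_zero.2 hr.ne')
  exact (h2.tendsto.mono_left nhdsWithin_le_nhds).pos_mul_atTop
    (div_pos (zpow_pos h0 _) (sub_pos.2 hr)) h1

theorem exists_isLeast_boundFun (hR : R.Admissible) (hh : 0 < h) (hd : 0 ≤ d) (ht : 0 ≤ t)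
    (hB : 0 < B) (hL : 0 < L) :
    ∃ ρ ∈ Set.Ioo 1 (rhoMax B), IsLeast (boundFun R Q h d t B L '' Set.Ioo 1 (rhoMax B))
      (boundFun R Q h d t B L ρ) := by
  have hr := one_lt_rhoMax hB
  have hc : 0 < Real.exp (-(L * t * R.gamma (h * L))) := Real.exp_pos _
  obtain ⟨ρ, hρ, hmin⟩ := exists_isMinOn_Ioo hr
    (lowerSemicontinuousOn_boundFun (d := d) Q hR hh ht hB hL)
    (tendsto_atTop_mono' _ (by
      filter_upwards [Ioo_mem_nhdsGT hr] with ρ hρ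
      exact boundPrefactor_mul_le_boundFun Q hR hh hd ht hB hL hρ)
      ((tendsto_boundPrefactor_left Q hB).atTop_mul_const hc))
    (tendsto_atTop_mono' _ (by
      filter_upwards [Ioo_mem_nhdsLT hr] with ρ hρ
      exact boundPrefactor_mul_le_boundFun Q hR hh hd ht hB hL hρ)
      ((tendsto_boundPrefactor_right Q hB).atTop_mul_const hc))
  refine ⟨ρ, hρ, ⟨ρ, hρ, rfl⟩, ?_⟩
  rintro _ ⟨r, hr, rfl⟩
  exact hmin hr

end Minimum

/-! ### Vector-valued quadrature errors -/

/-- A seminorm is attained at each vector by a functional that it dominates. -/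
theorem exists_dual_eq_seminorm {E : Type*} [AddCommGroup E] [Module ℂ E] (N : Seminorm ℂ E)
    (v : E) : ∃ φ : Module.Dual ℂ E, φ v = N v ∧ ∀ w, ‖φ w‖ ≤ N w := by
  rcases eq_or_ne v 0 with rfl | hv
  · exact ⟨0, by simp, fun w => by simp⟩
  obtain ⟨φ, h1, h2⟩ := Module.Dual.exists_extension_of_le_seminorm (𝕜 := ℂ)
    (Submodule.span ℂ {v})
    ((N v : ℂ) • (LinearEquiv.coord ℂ E v hv : Submodule.span ℂ {v} →ₗ[ℂ] ℂ)) (p := N)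
    (fun x => by
      rw [LinearMap.smul_apply, smul_eq_mul, norm_mul, Complex.norm_real,
        Real.norm_of_nonneg (apply_nonneg N v), mul_comm]
      conv_rhs => rw [← LinearEquiv.coord_apply_smul ℂ E v hv x, map_smul_eq_mul]
      rfl)
  refine ⟨φ, ?_, h2⟩
  have h3 := h1 ⟨v, Submodule.mem_span_singleton_self v⟩
  have h4 : (LinearEquiv.coord ℂ E v hv : Submodule.span ℂ {v} →ₗ[ℂ] ℂ)
      ⟨v, Submodule.mem_span_singleton_self v⟩ = 1 := LinearEquiv.coord_self ℂ E v hv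
  rw [LinearMap.smul_apply, h4, smul_eq_mul, mul_one] at h3
  exact h3

/-- A functional dominated by `N` and attaining it at the error vector commutes with integral and
sum, so the scalar estimate transfers with no loss of constant. -/
theorem seminorm_gaussError_le {m Q : ℕ} (N : Seminorm ℂ (Fin (m + 1) → ℂ))
    (g : GaussLegendreRule Q) (hQ : 1 ≤ Q) {Φ : ℂ → Fin (m + 1) → ℂ} {F : ℝ → Fin (m + 1) → ℂ}
    {a b ρ M : ℝ} (hab : a < b) (hρ : 1 < ρ) (hF : ∀ x ∈ Set.Icc a b, F x = Φ x)
    (hd : ∀ u : ℂ, 1 ≤ ‖u‖ → ‖u‖ ≤ ρ →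
      DifferentiableAt ℂ Φ (a + (b - a) / 2 * (joukowski u + 1)))
    (hM : ∀ u : ℂ, ‖u‖ = ρ → N (Φ (a + (b - a) / 2 * (joukowski u + 1))) ≤ M) :
    N (gaussError g F a b) ≤ (b - a) / 2 * (8 * M * (ρ ^ (-2 * (Q : ℤ) + 1) / (ρ - 1))) := by
  obtain ⟨φ, hφ, hle⟩ := exists_dual_eq_seminorm N (gaussError g F a b)
  set c : ℝ := (b - a) / 2 with hc
  have hc0 : 0 < c := by linarith
  set l : ℂ → ℂ := fun w => a + (b - a) / 2 * (w + 1) with hl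
  set f : ℂ → ℂ := fun w => φ (Φ (l w)) with hf
  let φL : (Fin (m + 1) → ℂ) →L[ℂ] ℂ := LinearMap.toContinuousLinearMap φ
  have hφL : ∀ v, φL v = φ v := fun v => rfl
  have hld : Differentiable ℂ l := by
    simp only [hl]
    fun_prop
  have hfd : ∀ u : ℂ, 1 ≤ ‖u‖ → ‖u‖ ≤ ρ → DifferentiableAt ℂ f (joukowski u) := by
    intro u h1 h2
    have h3 : DifferentiableAt ℂ (fun w => Φ (l w)) (joukowski u) :=
      DifferentiableAt.comp (g := Φ) _ (hd u h1 h2) (hld _)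
    exact DifferentiableAt.comp (g := φL) _ φL.differentiableAt h3
  have herr := g.norm_error_le hQ hρ hfd fun u hu => (hle _).trans (hM u hu)
  have hlx : ∀ y : ℝ, ((a + c * (y + 1) : ℝ) : ℂ) = l y := fun y => by
    simp only [hl, hc]
    push_cast
    ring
  have hmem : ∀ y ∈ Set.Icc (-1 : ℝ) 1, a + c * (y + 1) ∈ Set.Icc a b := fun y hy => by
    have hb : b = a + c * 2 := by
      rw [hc]
      ring
    constructor
    · linarith [mul_nonneg hc0.le (show 0 ≤ y + 1 by linarith [hy.1])]
    · linarith [mul_le_mul_of_nonneg_left (show y + 1 ≤ 2 by linarith [hy.2]) hc0.le]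
  have hFl : ∀ y ∈ Set.Icc (-1 : ℝ) 1, F (a + c * (y + 1)) = Φ (l y) := fun y hy => by
    rw [hF _ (hmem y hy), hlx]
  have hcont : ContinuousOn (fun y : ℝ => Φ (l y)) (Set.Icc (-1) 1) := by
    intro y hy
    have hj : joukowski (Complex.exp (Real.arccos y * Complex.I)) = y := by
      rw [joukowski_exp, Real.cos_arccos hy.1 hy.2]
    have hn := Complex.norm_exp_ofReal_mul_I (Real.arccos y)
    have h1 := (hd _ hn.ge (hn.le.trans hρ.le)).continuousAt
    rw [hj] at h1
    exact (ContinuousAt.comp (f := fun y : ℝ => l y) h1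
      (hld.continuous.comp Complex.continuous_ofReal).continuousAt).continuousWithinAt
  have hint : (∫ x in a..b, F x) = c • ∫ y in (-1 : ℝ)..1, Φ (l y) := by
    have h1 := intervalIntegral.smul_integral_comp_mul_add (a := -1) (b := 1) F c (a + c)
    rw [show c * -1 + (a + c) = a by ring, show c * 1 + (a + c) = b by rw [hc]; ring] at h1
    rw [← h1]
    congr 1
    refine intervalIntegral.integral_congr fun y hy => ?_
    rw [Set.uIcc_of_le (by norm_num)] at hy
    rw [← hFl y hy]
    congr 1
    ring
  have hφint : φ (∫ y in (-1 : ℝ)..1, Φ (l y)) = ∫ y in (-1 : ℝ)..1, f y := by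
    rw [← hφL, ← ContinuousLinearMap.intervalIntegral_comp_comm φL
      (ContinuousOn.intervalIntegrable (by rwa [Set.uIcc_of_le (by norm_num)]))]
    rfl
  have hval : φ (gaussError g F a b) =
      c * ((∫ y in (-1 : ℝ)..1, f y) - ∑ k, (g.weight k : ℂ) * f (g.node k)) := by
    rw [gaussError, hint, map_sub, map_sum, ← Complex.coe_smul, map_smul, hφint, mul_sub,
      Finset.mul_sum, smul_eq_mul]
    congr 1
    refine Finset.sum_congr rfl fun k _ => ?_
    rw [map_smul, smul_eq_mul, ← hc, hFl _ (g.node_mem k)]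
    push_cast
    ring
  have hnorm := congrArg norm (hφ.symm.trans hval)
  rw [norm_mul, Complex.norm_real, Complex.norm_real, Real.norm_of_nonneg (apply_nonneg N _),
    Real.norm_of_nonneg hc0.le] at hnorm
  rw [hnorm]
  exact mul_le_mul_of_nonneg_left herr hc0.le

/-! ### The kernel off the real axis -/

/-- The holomorphic branch of `√(i λ)` on `ℂ ∖ (-∞, 0]`. -/
noncomputable def sqrtI (lam : ℂ) : ℂ := Complex.exp (Real.pi / 4 * Complex.I) * lam ^ (2⁻¹ : ℂ)

/-- The holomorphic extension of `G(·, x)` to `ℂ ∖ (-∞, 0]`. -/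
noncomputable def jump (x : ℝ) (lam : ℂ) : ℂ :=
  -((Complex.exp (|x| * sqrtI lam) + Complex.exp (-(|x| * sqrtI lam))) / (2 * sqrtI lam))

theorem norm_sqrtI (lam : ℂ) : ‖sqrtI lam‖ = Real.sqrt ‖lam‖ := by
  have h1 : (lam ^ (2⁻¹ : ℂ)) ^ 2 = lam := by
    exact_mod_cast Complex.cpow_nat_inv_pow lam (n := 2) two_ne_zero
  have h2 : ‖lam ^ (2⁻¹ : ℂ)‖ = Real.sqrt ‖lam‖ := by
    conv_rhs => rw [← h1, norm_pow, Real.sqrt_sq (norm_nonneg _)]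
  have h3 : ‖Complex.exp (Real.pi / 4 * Complex.I)‖ = 1 := by
    have := Complex.norm_exp_ofReal_mul_I (Real.pi / 4)
    push_cast at this
    exact this
  rw [sqrtI, norm_mul, h2, h3, one_mul]

theorem sqrtI_ne_zero {lam : ℂ} (h : lam ≠ 0) : sqrtI lam ≠ 0 := by
  rw [← norm_ne_zero_iff, norm_sqrtI]
  exact (Real.sqrt_pos.2 (norm_pos_iff.2 h)).ne'

theorem differentiableAt_sqrtI {lam : ℂ} (h : 0 < lam.re) : DifferentiableAt ℂ sqrtI lam :=
  (DifferentiableAt.cpow_const differentiableAt_id (Or.inl h)).const_mul _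

theorem differentiableAt_jump (x : ℝ) {lam : ℂ} (h : 0 < lam.re) :
    DifferentiableAt ℂ (jump x) lam := by
  have h0 : lam ≠ 0 := by
    rintro rfl
    simp at h
  have h1 := (differentiableAt_sqrtI h).const_mul ((|x| : ℝ) : ℂ)
  exact ((h1.cexp.add h1.neg.cexp).div ((differentiableAt_sqrtI h).const_mul 2)
    (mul_ne_zero two_ne_zero (sqrtI_ne_zero h0))).neg

theorem sqrtI_ofReal {lam : ℝ} (h : 0 < lam) :
    sqrtI lam = Complex.exp (Real.pi / 4 * Complex.I) * (Real.sqrt lam : ℂ) := by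
  rw [sqrtI, Real.sqrt_eq_rpow, Complex.ofReal_cpow h.le]
  norm_num

/-- On the two sides of the cut the root `√(z/i)` takes the opposite values `± sqrtI lam`, since
`e^(-iπ/4) e^(±iπ/2) = ± e^(iπ/4)`. -/
theorem G_eq_jump (x : ℝ) {lam : ℝ} (h : 0 < lam) : G lam x = jump x lam := by
  have h0 : sqrtI lam ≠ 0 := sqrtI_ne_zero (by exact_mod_cast h.ne')
  have hp : Complex.exp (-(Real.pi / 4) * Complex.I) * (Real.sqrt lam : ℂ) *
      Complex.exp ((Real.pi : ℝ) / 2 * Complex.I) = sqrtI lam := by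
    rw [sqrtI_ofReal h, mul_right_comm, ← Complex.exp_add]
    congr 2
    ring
  have hn : Complex.exp (-(Real.pi / 4) * Complex.I) * (Real.sqrt lam : ℂ) *
      Complex.exp ((-Real.pi : ℝ) / 2 * Complex.I) = -sqrtI lam := by
    rw [sqrtI_ofReal h, mul_right_comm, ← Complex.exp_add, ← neg_mul, ← Complex.exp_sub_pi_mul_I]
    congr 2
    push_cast
    ring
  rw [G, kernelPolar, kernelPolar]
  simp only [hp, hn]
  rw [jump]
  simp only [mul_neg, neg_mul, neg_neg]
  field_simp
  ring

theorem norm_jump_le (x : ℝ) (lam : ℂ) :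
    ‖jump x lam‖ ≤ (Real.sqrt ‖lam‖)⁻¹ * Real.exp (|x| * Real.sqrt ‖lam‖) := by
  have h1 : ‖Complex.exp (|x| * sqrtI lam)‖ ≤ Real.exp (|x| * Real.sqrt ‖lam‖) := by
    refine (Complex.norm_exp_le_exp_norm _).trans_eq ?_
    rw [norm_mul, norm_sqrtI, Complex.norm_real, norm_abs_eq_norm, Real.norm_eq_abs]
  have h2 : ‖Complex.exp (-(|x| * sqrtI lam))‖ ≤ Real.exp (|x| * Real.sqrt ‖lam‖) := by
    refine (Complex.norm_exp_le_exp_norm _).trans_eq ?_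
    rw [norm_neg, norm_mul, norm_sqrtI, Complex.norm_real, norm_abs_eq_norm, Real.norm_eq_abs]
  rw [jump, norm_neg, norm_div, norm_mul, Complex.norm_ofNat, norm_sqrtI, div_eq_inv_mul, mul_inv]
  have h3 := (norm_add_le _ _).trans (add_le_add h1 h2)
  calc _ ≤ 2⁻¹ * (Real.sqrt ‖lam‖)⁻¹ *
        (Real.exp (|x| * Real.sqrt ‖lam‖) + Real.exp (|x| * Real.sqrt ‖lam‖)) := by gcongr
    _ = _ := by ring

/-! ### The transplanted Bernstein ellipse -/

section Ellipse

variable {B L ρ : ℝ} {u : ℂ}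

theorem abs_re_joukowski_le (h1 : 1 ≤ ‖u‖) (h2 : ‖u‖ ≤ ρ) :
    |(joukowski u).re| ≤ (ρ + ρ⁻¹) / 2 := by
  refine (Complex.abs_re_le_norm _).trans ?_
  rw [joukowski, norm_div, Complex.norm_ofNat]
  have h3 := norm_add_le u u⁻¹
  rw [norm_inv] at h3
  have h4 : ‖u‖ + ‖u‖⁻¹ ≤ ρ + ρ⁻¹ := by
    rcases h2.lt_or_eq with h | h
    · exact (add_inv_lt_add_inv h1 h).le
    · rw [h]
  linarith

theorem abs_im_joukowski_le (h1 : 1 ≤ ‖u‖) (h2 : ‖u‖ ≤ ρ) : |(joukowski u).im| ≤ ρ / 2 := by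
  -- The bracket lies in `[0, 1]` when `|u| ≥ 1`; bounding it by 1 gives `ρ/2` instead of the exact
  -- semi-axis `(ρ - ρ⁻¹)/2`.
  have h3 : (joukowski u).im = u.im * ((1 - (Complex.normSq u)⁻¹) / 2) := by
    rw [joukowski, show (2 : ℂ) = ((2 : ℝ) : ℂ) by norm_num, Complex.div_ofReal_im,
      Complex.add_im, Complex.inv_im]
    ring
  have h4 : 1 ≤ Complex.normSq u := by
    rw [Complex.normSq_eq_norm_sq]
    exact one_le_pow₀ h1
  have h5 : (Complex.normSq u)⁻¹ ≤ 1 := inv_le_one_of_one_le₀ h4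
  have h6 : 0 ≤ (Complex.normSq u)⁻¹ := by positivity
  rw [h3, abs_mul, abs_of_nonneg (show 0 ≤ (1 - (Complex.normSq u)⁻¹) / 2 by linarith)]
  have h7 := (Complex.abs_im_le_norm u).trans h2
  calc |u.im| * ((1 - (Complex.normSq u)⁻¹) / 2) ≤ ρ * (1 / 2) := by
        gcongr
        · linarith
        · linarith
    _ = ρ / 2 := by ring

theorem mul_etaMinus_le_re (hB : 0 < B) (hL : 0 < L) (h1 : 1 ≤ ‖u‖) (h2 : ‖u‖ ≤ ρ) :
    L * etaMinus B ρ ≤ ((L : ℂ) + B * L / 2 * (joukowski u + 1)).re := by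
  have h3 := (abs_le.1 (abs_re_joukowski_le h1 h2)).1
  have h4 : ((L : ℂ) + B * L / 2 * (joukowski u + 1)).re =
      L + B * L / 2 * ((joukowski u).re + 1) := by
    rw [show (L : ℂ) + B * L / 2 * (joukowski u + 1) =
      L + ((B * L / 2 : ℝ) : ℂ) * (joukowski u + 1) by push_cast; ring]
    simp
  rw [h4, etaMinus]
  have := mul_le_mul_of_nonneg_left h3 (mul_pos hB hL).le
  linarith

theorem re_le_mul_etaPlus (hB : 0 < B) (hL : 0 < L) (h1 : 1 ≤ ‖u‖) (h2 : ‖u‖ ≤ ρ) :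
    ((L : ℂ) + B * L / 2 * (joukowski u + 1)).re ≤ L * etaPlus B ρ := by
  have h3 := (abs_le.1 (abs_re_joukowski_le h1 h2)).2
  have h4 : ((L : ℂ) + B * L / 2 * (joukowski u + 1)).re =
      L + B * L / 2 * ((joukowski u).re + 1) := by
    rw [show (L : ℂ) + B * L / 2 * (joukowski u + 1) =
      L + ((B * L / 2 : ℝ) : ℂ) * (joukowski u + 1) by push_cast; ring]
    simp
  rw [h4, etaPlus]
  have := mul_le_mul_of_nonneg_left h3 (mul_pos hB hL).le
  linarith

theorem norm_le_mul_etaPlus (hB : 0 < B) (hL : 0 < L) (hρ : ρ ∈ Set.Ioo 1 (rhoMax B))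
    (h1 : 1 ≤ ‖u‖) (h2 : ‖u‖ ≤ ρ) :
    ‖(L : ℂ) + B * L / 2 * (joukowski u + 1)‖ ≤
      L * Real.sqrt (1 + (ρ / 2) ^ 2) * etaPlus B ρ := by
  have hm := mul_etaMinus_le_re hB hL h1 h2
  have hp := re_le_mul_etaPlus hB hL h1 h2
  have hη := half_mul_le_etaPlus hB hρ.1
  have hpos := (mul_pos hL (etaMinus_pos hB hρ.1.le hρ.2)).le.trans hm
  have him : ((L : ℂ) + B * L / 2 * (joukowski u + 1)).im = B * L / 2 * (joukowski u).im := by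
    rw [show (L : ℂ) + B * L / 2 * (joukowski u + 1) =
      L + ((B * L / 2 : ℝ) : ℂ) * (joukowski u + 1) by push_cast; ring]
    simp
  -- Using `B/2 ≤ η₊`, the imaginary part gets the same factor `L η₊` as the real part; Pythagoras
  -- then yields `√(1 + (ρ/2)²)`.
  have himle : |((L : ℂ) + B * L / 2 * (joukowski u + 1)).im| ≤ L * etaPlus B ρ * (ρ / 2) := by
    rw [him, abs_mul, abs_of_pos (by positivity)]
    have h3 := abs_im_joukowski_le h1 h2
    have : 0 < ρ := by linarith [hρ.1]
    have : 0 ≤ etaPlus B ρ := by linarith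
    calc B * L / 2 * |(joukowski u).im| = L * (B / 2) * |(joukowski u).im| := by ring
      _ ≤ _ := by gcongr
  set z := (L : ℂ) + B * L / 2 * (joukowski u + 1)
  have hη0 : 0 ≤ etaPlus B ρ := by linarith
  refine le_of_sq_le_sq ?_ (by positivity)
  rw [← Complex.normSq_eq_norm_sq, Complex.normSq_apply, mul_pow, mul_pow,
    Real.sq_sqrt (by positivity)]
  have e1 : z.re * z.re ≤ (L * etaPlus B ρ) ^ 2 := by
    rw [← sq]
    exact pow_le_pow_left₀ hpos hp 2
  have e2 : z.im * z.im ≤ (L * etaPlus B ρ * (ρ / 2)) ^ 2 := by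
    rw [← sq, ← sq_abs]
    exact pow_le_pow_left₀ (abs_nonneg _) himle 2
  calc _ ≤ _ := add_le_add e1 e2
    _ = _ := by ring

end Ellipse

/-! ### The quadrature error -/

section Tau

variable {m : ℕ} {R : RungeKutta m}

/-- The holomorphic extension of `integrand`. -/
noncomputable def integrandExt (R : RungeKutta m) (h x : ℝ) (n : ℕ) (lam : ℂ) :
    Fin (m + 1) → ℂ :=
  ((h : ℂ) / (2 * Real.pi * Complex.I) * jump x lam * R.stab (-(h * lam)) ^ n) •
    R.q (-(h * lam))

theorem re_neg_mul {h : ℝ} (lam : ℂ) : (-((h : ℂ) * lam)).re = -(h * lam.re) := by simp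

theorem integrand_eq (hR : R.Admissible) {h : ℝ} (hh : 0 < h) (x : ℝ) (n : ℕ) {lam : ℝ}
    (hlam : 0 < lam) : integrand R h x n lam = integrandExt R h x n lam := by
  funext k
  have hcast : ((-(h * lam) : ℝ) : ℂ) = -((h : ℂ) * lam) := by push_cast; ring
  have hu := hR.isUnit_of_re_nonpos (-((h : ℂ) * lam)) (by
    rw [re_neg_mul, Complex.ofReal_re]
    have := mul_pos hh hlam
    linarith)
  rw [integrand, integrandExt, Pi.smul_apply, Pi.smul_apply, G_eq_jump x hlam]
  simp only [smul_eq_mul, ← Complex.ofReal_mul, ← Complex.ofReal_neg] at *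
  rw [hR.e_eq hu]
  ring

theorem differentiableAt_integrandExt (hR : R.Admissible) {h : ℝ} (hh : 0 < h) (x : ℝ) (n : ℕ)
    {lam : ℂ} (hlam : 0 < lam.re) : DifferentiableAt ℂ (integrandExt R h x n) lam := by
  have hu := hR.isUnit_of_re_nonpos (-((h : ℂ) * lam)) (by
    rw [re_neg_mul]
    have := mul_pos hh hlam
    linarith)
  have hd : DifferentiableAt ℂ (fun w : ℂ => -((h : ℂ) * w)) lam := by fun_prop
  refine differentiableAt_pi.2 fun k => ?_
  exact (((differentiableAt_jump x hlam).const_mul _).mul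
    ((DifferentiableAt.comp (g := R.stab) lam (RungeKutta.differentiableAt_stab hu) hd).pow
      n)).mul (DifferentiableAt.comp (g := fun z => R.q z k) lam
        (RungeKutta.differentiableAt_q hu k) hd)

theorem seminorm_integrandExt_le (hR : R.Admissible) (N : Seminorm ℂ (Fin (m + 1) → ℂ))
    {h : ℝ} (hh : 0 < h) (x : ℝ) (n : ℕ) {lam : ℂ} {α β κ : ℝ} (hα : 0 < α) (hre : α ≤ lam.re)
    (hre' : lam.re ≤ β) (hκ : ‖lam‖ ≤ κ) :
    N (integrandExt R h x n lam) ≤ h / (2 * Real.pi) * ((Real.sqrt α)⁻¹ *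
      Real.exp (|x| * Real.sqrt κ)) * Real.exp (-(n * h * R.gamma (h * β) * α)) *
        sSup (R.qNorms N) := by
  have hlam : 0 < lam.re := hα.trans_le hre
  have hz := re_neg_mul (h := h) lam
  have hz0 : (-((h : ℂ) * lam)).re < 0 := by
    rw [hz]
    have := mul_pos hh hlam
    linarith
  have hq : N (R.q (-(h * lam))) ≤ sSup (R.qNorms N) :=
    le_csSup (hR.bddAbove_qNorms N) ⟨_, hz0.le, rfl⟩
  have hs : ‖R.stab (-(h * lam))‖ ^ n ≤ Real.exp (-(n * h * R.gamma (h * β) * α)) := by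
    -- The right edge `β` fixes the strip on which `γ` is taken, the left edge `α` the guaranteed
    -- decay.
    refine (hR.norm_stab_pow_le (ξ := h * β) (by rw [hz]; gcongr) hz0 n).trans
      (Real.exp_le_exp.2 ?_)
    rw [hz]
    have hγ := hR.gamma_nonneg (h * β)
    have : n * h * R.gamma (h * β) * α ≤ n * h * R.gamma (h * β) * lam.re := by gcongr
    linarith
  have hj : ‖jump x lam‖ ≤ (Real.sqrt α)⁻¹ * Real.exp (|x| * Real.sqrt κ) := by
    refine (norm_jump_le x lam).trans ?_
    have h1 : α ≤ ‖lam‖ := hre.trans (Complex.re_le_norm lam)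
    have h2 := Real.sqrt_pos.2 hα
    gcongr
  have hpre : ‖(h : ℂ) / (2 * Real.pi * Complex.I)‖ = h / (2 * Real.pi) := by
    rw [norm_div, norm_mul, norm_mul, Complex.norm_I, Complex.norm_ofNat, Complex.norm_real,
      Complex.norm_real, Real.norm_of_nonneg hh.le, Real.norm_of_nonneg Real.pi_pos.le, mul_one]
  rw [integrandExt, map_smul_eq_mul, norm_mul, norm_mul, norm_pow, hpre]
  have := Real.pi_pos
  gcongr

theorem endpoint_pos {B L₀ : ℝ} (hB : 0 < B) (hL : 0 < L₀) : ∀ j, 0 < endpoint B L₀ j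
  | 0 => hL
  | j + 1 => mul_pos (by linarith) (endpoint_pos hB hL j)

theorem seminorm_tau_le (hR : R.Admissible) (N : Seminorm ℂ (Fin (m + 1) → ℂ))
    {h B L₀ : ℝ} (hh : 0 < h) (x : ℝ) (hB : 0 < B) (hL₀ : 0 < L₀) (n : ℕ) {j Q : ℕ} (hj : 1 ≤ j)
    (hQ : 1 ≤ Q) (g : GaussLegendreRule Q) {ρ : ℝ} (hρ : ρ ∈ Set.Ioo 1 (rhoMax B)) :
    N (tau R g h x B L₀ n j) ≤ sSup (R.qNorms N) *
      (h * (2 * B * (endpoint B L₀ (j - 1)) ^ (1 / 2 : ℝ) / Real.pi)) *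
        boundFun R Q h |x| (n * h) B (endpoint B L₀ (j - 1)) ρ := by
  have hend : endpoint B L₀ j = (1 + B) * endpoint B L₀ (j - 1) := by
    conv_lhs => rw [← Nat.sub_add_cancel hj]
    rfl
  rw [tau, hend]
  have hL := endpoint_pos hB hL₀ (j - 1)
  set L := endpoint B L₀ (j - 1)
  have hlen : (1 + B) * L - L = B * L := by ring
  have hη := etaMinus_pos hB hρ.1.le hρ.2
  have hη' := one_le_etaPlus hB hρ.1
  have hpt : ∀ u : ℂ, (L : ℂ) + ((((1 + B) * L : ℝ) : ℂ) - L) / 2 * (joukowski u + 1) =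
      L + B * L / 2 * (joukowski u + 1) := fun u => by
    push_cast
    ring
  refine (seminorm_gaussError_le N g hQ (Φ := integrandExt R h x n) (ρ := ρ)
    (M := h / (2 * Real.pi) * ((Real.sqrt (L * etaMinus B ρ))⁻¹ *
      Real.exp (|x| * Real.sqrt (L * Real.sqrt (1 + (ρ / 2) ^ 2) * etaPlus B ρ))) *
        Real.exp (-(n * h * R.gamma (h * (L * etaPlus B ρ)) * (L * etaMinus B ρ))) *
          sSup (R.qNorms N))
    (by linarith [mul_pos hB hL]) hρ.1
    (fun y hy => integrand_eq hR hh x n (hL.trans_le hy.1)) (fun u h1 h2 => ?_)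
    (fun u hu => ?_)).trans (le_of_eq ?_)
  · rw [hpt]
    exact differentiableAt_integrandExt hR hh x n
      ((mul_pos hL hη).trans_le (mul_etaMinus_le_re hB hL h1 h2))
  · rw [hpt]
    have h1 : 1 ≤ ‖u‖ := hρ.1.le.trans hu.ge
    exact seminorm_integrandExt_le hR N hh x n (mul_pos hL hη) (mul_etaMinus_le_re hB hL h1 hu.le)
      (re_le_mul_etaPlus hB hL h1 hu.le) (norm_le_mul_etaPlus hB hL hρ h1 hu.le)
  · rw [hlen, boundFun, Real.sqrt_mul hL.le, Real.sqrt_mul (by positivity), Real.sqrt_mul hL.le,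
      sub_eq_add_neg (_ * _), Real.exp_add, Real.rpow_neg hη.le, ← Real.sqrt_eq_rpow, ← Real.sqrt_eq_rpow,
      ← Real.sqrt_eq_rpow]
    have h4 : (1 + (ρ / 2) ^ 2) ^ (1 / 4 : ℝ) = Real.sqrt (Real.sqrt (1 + (ρ / 2) ^ 2)) := by
      rw [Real.sqrt_eq_rpow, Real.sqrt_eq_rpow, ← Real.rpow_mul (by positivity)]
      norm_num
    rw [h4]
    -- The constant is `(BL/2) · 8 · h/(2π) · L^(-1/2) = 2 B L^(1/2) h/π`; one root of `L` cancels
    -- against the singularity of the jump.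
    have hLs : B * L = B * (Real.sqrt L * Real.sqrt L) := by rw [Real.mul_self_sqrt hL.le]
    have hL0 := (Real.sqrt_pos.2 hL).ne'
    have hη0 := (Real.sqrt_pos.2 hη).ne'
    have hρ1 : ρ - 1 ≠ 0 := by linarith [hρ.1]
    rw [show n * h * R.gamma (h * (L * etaPlus B ρ)) * (L * etaMinus B ρ) =
      L * (n * h) * R.gamma (h * L * etaPlus B ρ) * etaMinus B ρ by
        rw [mul_assoc h L]
        ring,
      show |x| * (Real.sqrt L * Real.sqrt (Real.sqrt (1 + (ρ / 2) ^ 2)) *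
        Real.sqrt (etaPlus B ρ)) = |x| * Real.sqrt L *
          Real.sqrt (Real.sqrt (1 + (ρ / 2) ^ 2)) * Real.sqrt (etaPlus B ρ) by ring, hLs, mul_inv]
    have hpi := Real.pi_ne_zero
    generalize Real.exp (-(L * (n * h) * R.gamma (h * L * etaPlus B ρ) * etaMinus B ρ)) = E₁
    generalize Real.exp (|x| * Real.sqrt L * Real.sqrt (Real.sqrt (1 + (ρ / 2) ^ 2)) *
      Real.sqrt (etaPlus B ρ)) = E₂
    generalize ρ ^ (-2 * (Q : ℤ) + 1) = Z
    generalize Real.sqrt (etaMinus B ρ) = η at *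
    generalize sSup (R.qNorms N) = C
    generalize Real.sqrt L = S at *
    field_simp
    ring

end Tau

end SchrodingerCQ

theorem corollary4p6 {m : ℕ} (R : SchrodingerCQ.RungeKutta m) (hR : R.Admissible)
    (N : Seminorm ℂ (Fin (m + 1) → ℂ)) :
    BddAbove (R.qNorms N) ∧
    ∀ (h x B L₀ : ℝ), 0 < h → 1 ≤ B → 0 < L₀ →
      ∀ (n j Q : ℕ), 1 ≤ j → 1 ≤ Q →
        ∃ M : ℝ,
          IsLeast (SchrodingerCQ.boundFun R Q h |x| (n * h) B
            (SchrodingerCQ.endpoint B L₀ (j - 1)) '' Set.Ioo 1 (SchrodingerCQ.rhoMax B)) M ∧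
          ∀ g : SchrodingerCQ.GaussLegendreRule Q,
            N (SchrodingerCQ.tau R g h x B L₀ n j) ≤
              sSup (R.qNorms N) *
                (h * (2 * B * (SchrodingerCQ.endpoint B L₀ (j - 1)) ^ (1 / 2 : ℝ) / Real.pi)) *
                M := by
  refine ⟨hR.bddAbove_qNorms N, fun h x B L₀ hh hB hL₀ n j Q hj hQ => ?_⟩
  have hB0 : 0 < B := by linarith
  obtain ⟨ρ, hρ, hleast⟩ := SchrodingerCQ.exists_isLeast_boundFun (d := |x|) (t := n * h) Q hR hh
    (abs_nonneg x) (by positivity) hB0 (SchrodingerCQ.endpoint_pos hB0 hL₀ (j - 1))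
  exact ⟨_, hleast, fun g => SchrodingerCQ.seminorm_tau_le hR N hh x hB0 hL₀ n hj hQ g hρ⟩
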